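/- **Setting.** Let $\mu\in\mathbb R^d$ be a fixed signal vector. A training sample $i\in[n]$ has a true label $y_i\in\{\pm1\}$, an observed label $\tilde y_i\in\{\pm1\}$, and an input $x_i$ consisting of the two patches $y_i\mu$ and $\xi_i$, where $\xi_i\sim\mathcal N(0,\sigma_\xi^2 I_d)$. The labels are either (a) fixed and balanced: for $y=\pm1$, writing $\tau_{1}=\tau_+$, $\tau_{-1}=\tau_-$, exactly $(1-\tau_{y})n/2$ samples have $y_i=y=\tilde y_i$ and exactly $\tau_{y}n/2$ have $y_i=y\ne\tilde y_i$; or (b) random: the pairs $(y_i,\tilde y_i)$ are i.i.d. with $\mathbb P(y_i=\pm1)=\tfrac12$, $\mathbb P(\tilde y_i=-1\mid y_i=1)=\tau_+$, $\mathbb P(\tilde y_i=1\mid y_i=-1)=\tau_-$. The network is $f(W,x)=F_{+1}(W,x)-F_{-1}(W,x)$ with $F_j(W,x_i)=\frac1m\sum_{r=1}^m\big(\sigma(\langle w_{j,r},y_i\mu\rangle)+\sigma(\langle w_{j,r},\xi_i\rangle)\big)$ and $\sigma(z)=\max\{0,z\}$. It is initialized with $w^{(0)}_{j,r}\sim\mathcal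 N(0,\sigma_0^2I_d)$ ($j=\pm1$, $r\in[m]$); the labels, noise patches and initial weights are all independent. It is trained by gradient descent with step size $\eta$ on the logistic loss, $$w_{j,r}^{(t+1)}=w_{j,r}^{(t)}-\frac{\eta}{nm}\sum_{i=1}^n\ell_i'^{(t)}\sigma'(\langle w_{j,r}^{(t)},\xi_i\rangle)\,j\tilde y_i\,\xi_i-\frac{\eta}{nm}\sum_{i=1}^n\ell_i'^{(t)}\sigma'(\langle w_{j,r}^{(t)},y_i\mu\rangle)\,jy_i\tilde y_i\,\mu,$$ where $\ell_i'^{(t)}=-1/(1+\exp(\tilde y_if(W^{(t)},x_i)))$ and $\sigma'(z)=\mathbb 1(z\ge0)$. The signal coefficients $\gamma_{j,r}^{(t)}$ and noise coefficients $\rho_{j,r,i}^{(t)}$ are defined by $$w_{j,r}^{(t)}=w_{j,r}^{(0)}+j\gamma_{j,r}^{(t)}\|\mu\|_2^{-2}\mu+\sum_{i=1}^n\rho_{j,r,i}^{(t)}\|\xi_i\|_2^{-2}\xi_i ,$$ and $\overline\rho_{j,r,i}^{(t)}=\rho_{j,r,i}^{(t)}\mathbb 1(\rho_{j,r,i}^{(t)}\ge0)$.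 Let $\mathrm{SNR}=\|\mu\|_2/(\sigma_\xi\sqrt d)$. **Theorem.** Let $\kappa_{lo}\le\kappa_{hi}$ and $0<\tau_{lo}\le\tau_{hi}<\frac12$ be constants with $\kappa_{lo}(1-2\tau_{hi})>2$. There are constants $C,c,c'>0$, depending only on $\kappa_{lo},\kappa_{hi},\tau_{lo},\tau_{hi}$, such that the following holds whenever $n\ge2$, $\delta\in(0,1)$, $\sigma_\xi,\sigma_0,\eta>0$ and 1. $\kappa_{lo}\le n\cdot\mathrm{SNR}^2\le\kappa_{hi}$ and $\tau_+,\tau_-\in[\tau_{lo},\tau_{hi}]$; 2. $d\ge C\max\{n^2\log(nm/\delta),\ n\|\mu\|_2\sigma_\xi^{-1}\sqrt{\log(n/\delta)}\}$; 3. $m\ge C\log(n/\delta)$ and $n\ge C\log(m/\delta)$; 4. $\|\mu\|_2^2\ge C\sigma_\xi^2\log(n/\delta)$; 5. $\sigma_0\le C^{-1}\min\{\sqrt n\,\sigma_\xi^{-1}d^{-1},\ \|\mu\|_2^{-1}\log(m/\delta)^{-1/2}\}$; 6. $\eta\le C^{-1}\min\{\sigma_\xi^{-2}d^{-3/2}n^2m\sqrt{\log(n/\delta)},\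 \sigma_\xi^{-2}d^{-1}n\}$. There is an integer $T_1$ with $c\,\eta^{-1}nm\sigma_\xi^{-2}d^{-1}\le T_1\le c'\,\eta^{-1}nm\sigma_\xi^{-2}d^{-1}$ such that, in each of the label models (a) and (b), with probability at least $1-\delta$ the decomposition of $W^{(T_1)}$ exists and is unique and * $c\le\overline\rho_{\tilde y_i,r,i}^{(T_1)}\le c'$ for all $i\in[n]$, $r\in[m]$ with $\langle w_{\tilde y_i,r}^{(0)},\xi_i\rangle\ge0$; * $c\le\gamma_{j,r}^{(T_1)}\le c'$ for all $j=\pm1$, $r\in[m]$; * $\gamma_{j,r}^{(T_1)}>\overline\rho_{\tilde y_i,r',i}^{(T_1)}$ for all $j=\pm1$, $r,r'\in[m]$, $i\in[n]$; * $\tilde y_if(W^{(T_1)},x_i)\ge0$ for every clean sample ($\tilde y_i=y_i$); * $\tilde y_if(W^{(T_1)},x_i)\le0$ for every noisy sample ($\tilde y_i\ne y_i$). -/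

import Mathlib

namespace LabelNoiseCNN

open MeasureTheory ProbabilityTheory

/-- The patch space `ℝ^d` with its Euclidean norm. -/
abbrev Patch (d : ℕ) := EuclideanSpace ℝ (Fin d)

/-- Labels and output signs are the units `1` and `-1` of `ℤ`; this is their value in `ℝ`. -/
def sgn (j : ℤˣ) : ℝ := ((j : ℤ) : ℝ)

/-- First-layer weights `w_{j,r}`, `j = ±1`, `r ∈ [m]`. -/
abbrev Weights (m d : ℕ) := ℤˣ → Fin m → Patch d

/-- A training set of size `n` with signal vector `μ`: true labels `y_i`, observed labels `ỹ_i`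
and noise patches `ξ_i`. -/
structure TrainingSet (n d : ℕ) where
  signal : Patch d
  y : Fin n → ℤˣ
  yObs : Fin n → ℤˣ
  noise : Fin n → Patch d

/-- The two patches of the `i`-th input. Their order is immaterial, because the network below is
symmetric in the two patches. -/
def TrainingSet.input {n d : ℕ} (S : TrainingSet n d) (i : Fin n) : Patch d × Patch d :=
  (sgn (S.y i) • S.signal, S.noise i)

/-! ### The network and gradient descent -/

noncomputable def relu (x : ℝ) : ℝ := max 0 x

/-- The derivative of ReLU, with value `1` at the kink. -/
noncomputable def reluDeriv (x : ℝ) : ℝ := if 0 ≤ x then 1 else 0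

/-- `F_j(W_j, x)`. -/
noncomputable def branch {m d : ℕ} (W : Weights m d) (j : ℤˣ) (x : Patch d × Patch d) : ℝ :=
  (1 / (m : ℝ)) * ∑ r : Fin m, (relu (inner ℝ (W j r) x.1) + relu (inner ℝ (W j r) x.2))

/-- `f(W, x) = F_{+1}(W_{+1}, x) - F_{-1}(W_{-1}, x)`. -/
noncomputable def network {m d : ℕ} (W : Weights m d) (x : Patch d × Patch d) : ℝ :=
  branch W 1 x - branch W (-1) x

/-- The loss derivative `ℓ'_i = -1 / (1 + exp (ỹ_i f(W, x_i)))` of the logistic loss. -/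
noncomputable def lossDeriv {n m d : ℕ} (S : TrainingSet n d) (W : Weights m d) (i : Fin n) : ℝ :=
  -(1 / (1 + Real.exp (sgn (S.yObs i) * network W (S.input i))))

/-- One step of full-batch gradient descent on the empirical logistic risk, learning rate `η`. -/
noncomputable def gdStep {n m d : ℕ} (S : TrainingSet n d) (η : ℝ) (W : Weights m d) :
    Weights m d := fun j r =>
  W j r
    - (η / ((n : ℝ) * m)) • ∑ i : Fin n,
        (lossDeriv S W i * reluDeriv (inner ℝ (W j r) (S.noise i))
          * sgn j * sgn (S.yObs i)) • S.noise i
    - (η / ((n : ℝ) * m)) • ∑ i : Fin n,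
        (lossDeriv S W i * reluDeriv (inner ℝ (W j r) (sgn (S.y i) • S.signal))
          * sgn j * sgn (S.y i) * sgn (S.yObs i)) • S.signal

/-- The weights `W^{(t)}` started from `W₀`. -/
noncomputable def gdIter {n m d : ℕ} (S : TrainingSet n d) (η : ℝ) (W₀ : Weights m d) :
    ℕ → Weights m d
  | 0 => W₀
  | t + 1 => gdStep S η (gdIter S η W₀ t)

/-! ### Signal-noise decomposition -/

/-- Signal coefficients `γ_{j,r}` and noise coefficients `ρ_{j,r,i}`. -/
structure Coeffs (n m : ℕ) where
  γ : ℤˣ → Fin m → ℝ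
  ρ : ℤˣ → Fin m → Fin n → ℝ

/-- `ρ̄_{j,r,i} = ρ_{j,r,i} 𝟙(ρ_{j,r,i} ≥ 0)`. -/
noncomputable def Coeffs.ρpos {n m : ℕ} (c : Coeffs n m) (j : ℤˣ) (r : Fin m) (i : Fin n) : ℝ :=
  if 0 ≤ c.ρ j r i then c.ρ j r i else 0

/-- `c` are coefficients of `W` in the signal-noise decomposition
`w_{j,r} = w_{j,r}^{(0)} + j γ_{j,r} ‖μ‖⁻² μ + ∑ i, ρ_{j,r,i} ‖ξ_i‖⁻² ξ_i`. -/
def IsDecomposition {n m d : ℕ} (S : TrainingSet n d) (W₀ W : Weights m d) (c : Coeffs n m) :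
    Prop :=
  ∀ j r, W j r = W₀ j r + (sgn j * c.γ j r * (‖S.signal‖ ^ 2)⁻¹) • S.signal
    + ∑ i : Fin n, (c.ρ j r i * (‖S.noise i‖ ^ 2)⁻¹) • S.noise i

/-! ### Probability model -/

/-- `N(0, σ² I_d)`. -/
noncomputable def isoGaussian (d : ℕ) (σ : ℝ) : Measure (Patch d) :=
  (stdGaussian (Patch d)).map (fun x => σ • x)

/-- Joint law of the noise patches `ξ_i ~ N(0, σξ² I)` and of the initial weights
`w_{j,r} ~ N(0, σ0² I)`, all independent. -/
noncomputable def noiseInitLaw (n m d : ℕ) (σξ σ0 : ℝ) :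
    Measure ((Fin n → Patch d) × Weights m d) :=
  (Measure.pi fun _ : Fin n => isoGaussian d σξ).prod
    (Measure.pi fun _ : ℤˣ => Measure.pi fun _ : Fin m => isoGaussian d σ0)

/-- Probability that the observed label differs from the true label `y`. -/
noncomputable def flipProb (τp τm : ℝ) (y : ℤˣ) : ℝ := if y = 1 then τp else τm

/-- Joint law of `(y, ỹ)`: `y` is uniform on `±1`, and `ỹ ≠ y` with conditional
probability `flipProb τp τm y`. -/
noncomputable def labelLaw (τp τm : ℝ) : Measure (ℤˣ × ℤˣ) :=
  ∑ y : ℤˣ, ∑ y' : ℤˣ,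
    ENNReal.ofReal (1 / 2 * (if y' = y then 1 - flipProb τp τm y else flipProb τp τm y)) •
      Measure.dirac (y, y')

/-- A balanced labelled sample: half of the true labels are `1`, half are `-1`, and within each
class the fraction of flipped labels equals the flip probability. -/
def BalancedLabels {n : ℕ} (τp τm : ℝ) (y yObs : Fin n → ℤˣ) : Prop :=
  ∀ a : ℤˣ,
    ((Finset.univ.filter fun i => y i = a ∧ yObs i = y i).card : ℝ)
        = (1 - flipProb τp τm a) * n / 2 ∧
    ((Finset.univ.filter fun i => y i = a ∧ yObs i ≠ y i).card : ℝ)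
        = flipProb τp τm a * n / 2

/-! ### The parameter regime and the end of the first stage -/

/-- Signal-to-noise ratio `‖μ‖ / (σξ √d)`. -/
noncomputable def snr {d : ℕ} (μ : Patch d) (σξ : ℝ) : ℝ := ‖μ‖ / (σξ * √(d : ℝ))

/-- The parameter regime, with large constant `C`; `κlo, κhi` and `τlo, τhi` are the constants
behind `n · SNR² = Θ(1)` and `τ₊, τ₋ = Θ(1)`. -/
structure Regime (C κlo κhi τlo τhi : ℝ) (n m d : ℕ) (μ : Patch d)
    (σξ σ0 η δ τp τm : ℝ) : Prop where
  two_le_n : 2 ≤ n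
  δ_pos : 0 < δ
  δ_lt_one : δ < 1
  σξ_pos : 0 < σξ
  σ0_pos : 0 < σ0
  η_pos : 0 < η
  snr_lower : κlo ≤ n * snr μ σξ ^ 2
  snr_upper : n * snr μ σξ ^ 2 ≤ κhi
  τp_mem : τp ∈ Set.Icc τlo τhi
  τm_mem : τm ∈ Set.Icc τlo τhi
  d_large : C * max ((n : ℝ) ^ 2 * Real.log (n * m / δ))
    (n * ‖μ‖ * σξ⁻¹ * √(Real.log (n / δ))) ≤ d
  m_large : C * Real.log (n / δ) ≤ m
  n_large : C * Real.log (m / δ) ≤ n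
  signal_large : C * σξ ^ 2 * Real.log (n / δ) ≤ ‖μ‖ ^ 2
  σ0_small : σ0 ≤ C⁻¹ * min (√(n : ℝ) * σξ⁻¹ * (d : ℝ)⁻¹) (‖μ‖⁻¹ * (√(Real.log (m / δ)))⁻¹)
  η_small : η ≤ C⁻¹ * min
    ((σξ ^ 2)⁻¹ * ((d : ℝ) * √(d : ℝ))⁻¹ * (n : ℝ) ^ 2 * m * √(Real.log (n / δ)))
    ((σξ ^ 2)⁻¹ * (d : ℝ)⁻¹ * n)

/-- What is asserted about the weights `W^{(T)}`, with `lo, hi` the constants behind `Θ(1)`: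
the signal-noise decomposition exists and is unique, and its coefficients and the network outputs
on the training inputs are as claimed. -/
def StageOneOutcome {n m d : ℕ} (lo hi : ℝ) (S : TrainingSet n d) (η : ℝ) (W₀ : Weights m d)
    (T : ℕ) : Prop :=
  (∃! c : Coeffs n m, IsDecomposition S W₀ (gdIter S η W₀ T) c) ∧
  (∀ c : Coeffs n m, IsDecomposition S W₀ (gdIter S η W₀ T) c →
    (∀ i r, 0 ≤ inner ℝ (W₀ (S.yObs i) r) (S.noise i) →
      c.ρpos (S.yObs i) r i ∈ Set.Icc lo hi) ∧
    (∀ j r, c.γ j r ∈ Set.Icc lo hi) ∧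
    (∀ j r r' i, c.ρpos (S.yObs i) r' i < c.γ j r)) ∧
  (∀ i, S.yObs i = S.y i → 0 ≤ sgn (S.yObs i) * network (gdIter S η W₀ T) (S.input i)) ∧
  (∀ i, S.yObs i ≠ S.y i → sgn (S.yObs i) * network (gdIter S η W₀ T) (S.input i) ≤ 0)

end LabelNoiseCNN

/-! Gradient descent moves every neuron inside the span of the signal and the noise patches, and
the coefficients `γ` and `ρ` of its displacement satisfy explicit recursions. With high
probability the patches are nearly orthogonal and the initial weights are nearly orthogonal to
all of them, so the preactivations are the coefficients up to small errors. On a short time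
scale, measured in units of `n m / (η σξ² d)`, the network outputs remain small and every loss
derivative stays near `-1/2`. During that time the coefficient of an active noise patch grows at
a rate of about `1/2`. Clean labels outnumber flipped ones in each class, so every `γ` grows at
a rate of at least about `n SNR² (1 - 2 τ) / 4`, which is above `1/2`. The signal therefore
overtakes the noise on every sample, and the network predicts true labels: it is right on the
clean samples and wrong on the noisy ones. -/

namespace LabelNoiseCNN

open MeasureTheory ProbabilityTheory

/-! ### The network and the loss near zero output -/

lemma sgn_mul_self (j : ℤˣ) : sgn j * sgn j = 1 := by
  rcases Int.units_eq_one_or j with rfl | rfl <;> simp [sgn]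

lemma abs_sgn (j : ℤˣ) : |sgn j| = 1 := by
  rcases Int.units_eq_one_or j with rfl | rfl <;> simp [sgn]

lemma sgn_neg (j : ℤˣ) : sgn (-j) = -sgn j := by simp [sgn]

lemma relu_nonneg (x : ℝ) : 0 ≤ relu x := le_max_left _ _

lemma le_relu (x : ℝ) : x ≤ relu x := le_max_right _ _

lemma relu_le {x b : ℝ} (hb : 0 ≤ b) (h : x ≤ b) : relu x ≤ b := max_le hb h

lemma reluDeriv_nonneg (x : ℝ) : 0 ≤ reluDeriv x := by unfold reluDeriv; split_ifs <;> norm_num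

lemma reluDeriv_le_one (x : ℝ) : reluDeriv x ≤ 1 := by unfold reluDeriv; split_ifs <;> norm_num

lemma abs_sigmoid_sub_half_le (x : ℝ) : |Real.sigmoid x - 1 / 2| ≤ |x| := by
  have hderiv : ∀ y ∈ Set.univ, ‖deriv Real.sigmoid y‖ ≤ 1 := fun y _ ↦ by
    have h₀ := Real.sigmoid_nonneg y
    have h₁ := Real.sigmoid_le_one y
    rw [Real.deriv_sigmoid, Real.norm_of_nonneg (mul_nonneg h₀ (sub_nonneg.2 h₁))]
    nlinarith
  simpa using convex_univ.norm_image_sub_le_of_norm_deriv_le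
    (fun y _ ↦ differentiableAt_sigmoid) hderiv (Set.mem_univ 0) (Set.mem_univ x)

section Network

variable {n m d : ℕ} {W : Weights m d} {j : ℤˣ} {x : Patch d × Patch d} {b : ℝ}

lemma branch_nonneg : 0 ≤ branch W j x :=
  mul_nonneg (by positivity)
    (Finset.sum_nonneg fun _ _ ↦ add_nonneg (relu_nonneg _) (relu_nonneg _))

lemma branch_le (hm : 0 < m)
    (h : ∀ r, relu (inner ℝ (W j r) x.1) + relu (inner ℝ (W j r) x.2) ≤ b) : branch W j x ≤ b := by
  have hm' : (0 : ℝ) < m := by exact_mod_cast hm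
  rw [branch, one_div, inv_mul_le_iff₀ hm']
  simpa using Finset.sum_le_card_nsmul Finset.univ _ b fun r _ ↦ h r

lemma le_branch (hm : 0 < m)
    (h : ∀ r, b ≤ relu (inner ℝ (W j r) x.1) + relu (inner ℝ (W j r) x.2)) : b ≤ branch W j x := by
  have hm' : (0 : ℝ) < m := by exact_mod_cast hm
  rw [branch, one_div, le_inv_mul_iff₀ hm']
  simpa using Finset.card_nsmul_le_sum Finset.univ _ b fun r _ ↦ h r

lemma sgn_mul_network (W : Weights m d) (j : ℤˣ) (x : Patch d × Patch d) :
    sgn j * network W x = branch W j x - branch W (-j) x := by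
  rcases Int.units_eq_one_or j with rfl | rfl <;> simp [sgn, network]

lemma abs_network_le (hm : 0 < m)
    (h : ∀ j r, relu (inner ℝ (W j r) x.1) + relu (inner ℝ (W j r) x.2) ≤ b) :
    |network W x| ≤ b :=
  abs_sub_le_of_nonneg_of_le branch_nonneg (branch_le hm (h 1)) branch_nonneg
    (branch_le hm (h (-1)))

variable (S : TrainingSet n d) (W : Weights m d) (i : Fin n)

lemma neg_lossDeriv :
    -lossDeriv S W i = Real.sigmoid (-(sgn (S.yObs i) * network W (S.input i))) := by
  rw [lossDeriv, neg_neg, Real.sigmoid, neg_neg, one_div]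

lemma neg_lossDeriv_nonneg : 0 ≤ -lossDeriv S W i := neg_lossDeriv S W i ▸ Real.sigmoid_nonneg _

lemma neg_lossDeriv_le_one : -lossDeriv S W i ≤ 1 := neg_lossDeriv S W i ▸ Real.sigmoid_le_one _

lemma abs_neg_lossDeriv_sub_half_le : |-lossDeriv S W i - 1 / 2| ≤ |network W (S.input i)| := by
  have h := abs_sigmoid_sub_half_le (-(sgn (S.yObs i) * network W (S.input i)))
  rwa [abs_neg, abs_mul, abs_sgn, one_mul, ← neg_lossDeriv] at h

end Network

/-! ### Nearly orthogonal patches -/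

section NearlyOrthogonal

variable {E : Type*} [NormedAddCommGroup E] [InnerProductSpace ℝ E] {n : ℕ}

/-- The noise patches `ξ i` have squared norm about `v`, and their inner products with each other
and with the signal `μ` are so small that `n` of them add up to at most `ε * v`. -/
structure NearlyOrthogonal (ε v : ℝ) (μ : E) (ξ : Fin n → E) : Prop where
  norm_sq : ∀ i, |‖ξ i‖ ^ 2 - v| ≤ ε * v
  noise : ∀ i k, i ≠ k → n * |inner ℝ (ξ i) (ξ k)| ≤ ε * v
  signal : ∀ i, n * |inner ℝ (ξ i) μ| ≤ ε * v

/-- The linear combination of signal and noise patches whose coefficients with respect to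
`‖μ‖⁻² μ` and `‖ξ i‖⁻² ξ i` are given; these are the coefficients of the signal-noise
decomposition. -/
noncomputable def patchComb (μ : E) (ξ : Fin n → E) : ℝ × (Fin n → ℝ) →ₗ[ℝ] E :=
  (LinearMap.toSpanSingleton ℝ E ((‖μ‖ ^ 2)⁻¹ • μ)).coprod
    (Fintype.linearCombination ℝ fun i ↦ (‖ξ i‖ ^ 2)⁻¹ • ξ i)

variable {ε v : ℝ} {μ : E} {ξ : Fin n → E}

lemma patchComb_apply (p : ℝ × (Fin n → ℝ)) :
    patchComb μ ξ p = (p.1 * (‖μ‖ ^ 2)⁻¹) • μ + ∑ i, (p.2 i * (‖ξ i‖ ^ 2)⁻¹) • ξ i := by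
  simp [patchComb, Fintype.linearCombination_apply, smul_smul]

lemma inner_patchComb (p : ℝ × (Fin n → ℝ)) (x : E) :
    inner ℝ (patchComb μ ξ p) x
      = p.1 * (‖μ‖ ^ 2)⁻¹ * inner ℝ μ x + ∑ i, p.2 i * (‖ξ i‖ ^ 2)⁻¹ * inner ℝ (ξ i) x := by
  simp [patchComb_apply, inner_add_left, sum_inner, inner_smul_left]

namespace NearlyOrthogonal

lemma half_le_norm_sq (h : NearlyOrthogonal ε v μ ξ) (hε : ε ≤ 1 / 2) (hv : 0 < v) (i : Fin n) :
    v / 2 ≤ ‖ξ i‖ ^ 2 := by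
  have := (abs_le.1 (h.norm_sq i)).1
  nlinarith

lemma abs_sum_inv_norm_sq_mul_le (h : NearlyOrthogonal ε v μ ξ) (hε₀ : 0 ≤ ε) (hε : ε ≤ 1 / 2)
    (hv : 0 < v) (ρ : Fin n → ℝ) {s : Finset (Fin n)} {f : Fin n → ℝ}
    (hf : ∀ i ∈ s, n * |f i| ≤ ε * v) :
    |∑ i ∈ s, ρ i * (‖ξ i‖ ^ 2)⁻¹ * f i| ≤ 2 * ε * ‖ρ‖ := by
  have term : ∀ i ∈ s, |ρ i * (‖ξ i‖ ^ 2)⁻¹ * f i| ≤ 2 * ε * ‖ρ‖ / n := fun i hi ↦ by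
    have hn : (0 : ℝ) < n := by exact_mod_cast Fin.pos i
    have hinv : |(‖ξ i‖ ^ 2)⁻¹| ≤ 2 / v := by
      rw [abs_of_nonneg (by positivity), ← inv_div]
      exact inv_anti₀ (by positivity) (h.half_le_norm_sq hε hv i)
    have hfi : |f i| ≤ ε * v / n := (le_div_iff₀' hn).2 (hf i hi)
    calc |ρ i * (‖ξ i‖ ^ 2)⁻¹ * f i| = |ρ i| * |(‖ξ i‖ ^ 2)⁻¹| * |f i| := by rw [abs_mul, abs_mul]
      _ ≤ ‖ρ‖ * (2 / v) * (ε * v / n) := by gcongr; exact norm_le_pi_norm ρ i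
      _ = 2 * ε * ‖ρ‖ / n := by field_simp
  calc |∑ i ∈ s, ρ i * (‖ξ i‖ ^ 2)⁻¹ * f i| ≤ s.card * (2 * ε * ‖ρ‖ / n) := by
        rw [← nsmul_eq_mul]
        exact (Finset.abs_sum_le_sum_abs _ _).trans (Finset.sum_le_card_nsmul s _ _ term)
    _ = s.card / n * (2 * ε * ‖ρ‖) := by ring
    _ ≤ 2 * ε * ‖ρ‖ := by
        refine mul_le_of_le_one_left (by positivity) (div_le_one_of_le₀ ?_ n.cast_nonneg)
        simpa using s.card_le_univ

lemma abs_inner_signal_sub_le (h : NearlyOrthogonal ε v μ ξ) (hε₀ : 0 ≤ ε) (hε : ε ≤ 1 / 2)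
    (hv : 0 < v) (hμ : μ ≠ 0) (p : ℝ × (Fin n → ℝ)) :
    |inner ℝ (patchComb μ ξ p) μ - p.1| ≤ 3 * ε * ‖p‖ := by
  have hμ' : ‖μ‖ ^ 2 ≠ 0 := by simpa using hμ
  rw [inner_patchComb, real_inner_self_eq_norm_sq, inv_mul_cancel_right₀ hμ', add_sub_cancel_left]
  refine (h.abs_sum_inv_norm_sq_mul_le hε₀ hε hv p.2 fun i _ ↦ h.signal i).trans ?_
  gcongr
  · norm_num
  · exact norm_snd_le p

lemma abs_inner_noise_sub_le (h : NearlyOrthogonal ε v μ ξ) (hε₀ : 0 ≤ ε) (hε : ε ≤ 1 / 2)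
    (hv : 0 < v) (hμ : μ ≠ 0) (hvμ : v ≤ n * ‖μ‖ ^ 2) (p : ℝ × (Fin n → ℝ)) (i : Fin n) :
    |inner ℝ (patchComb μ ξ p) (ξ i) - p.2 i| ≤ 3 * ε * ‖p‖ := by
  have hn : (0 : ℝ) < n := by exact_mod_cast Fin.pos i
  have hμ₀ : 0 < ‖μ‖ ^ 2 := by positivity
  have hξ₀ : ‖ξ i‖ ^ 2 ≠ 0 := ((half_pos hv).trans_le (h.half_le_norm_sq hε hv i)).ne'
  have hdiag : inner ℝ (patchComb μ ξ p) (ξ i) - p.2 i = p.1 * ((‖μ‖ ^ 2)⁻¹ * inner ℝ μ (ξ i))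
      + ∑ k ∈ Finset.univ.erase i, p.2 k * (‖ξ k‖ ^ 2)⁻¹ * inner ℝ (ξ k) (ξ i) := by
    rw [inner_patchComb, ← Finset.add_sum_erase _ _ (Finset.mem_univ i),
      real_inner_self_eq_norm_sq, inv_mul_cancel_right₀ hξ₀]
    ring
  have hsignal : |(‖μ‖ ^ 2)⁻¹ * inner ℝ μ (ξ i)| ≤ ε := by
    rw [abs_mul, abs_of_pos (inv_pos.2 hμ₀), real_inner_comm, inv_mul_le_iff₀ hμ₀]
    refine le_of_mul_le_mul_left ?_ hn
    nlinarith [h.signal i]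
  have hnoise := h.abs_sum_inv_norm_sq_mul_le hε₀ hε hv p.2 (s := Finset.univ.erase i)
    (f := fun k ↦ inner ℝ (ξ k) (ξ i)) fun k hk ↦ h.noise k i (Finset.ne_of_mem_erase hk)
  calc |inner ℝ (patchComb μ ξ p) (ξ i) - p.2 i|
      ≤ |p.1| * |(‖μ‖ ^ 2)⁻¹ * inner ℝ μ (ξ i)| + 2 * ε * ‖p.2‖ := by
        rw [hdiag, ← abs_mul]; exact (abs_add_le _ _).trans (by gcongr)
    _ ≤ ‖p‖ * ε + 2 * ε * ‖p‖ := by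
        gcongr
        exacts [norm_fst_le p, norm_snd_le p]
    _ = 3 * ε * ‖p‖ := by ring

lemma patchComb_injective (h : NearlyOrthogonal ε v μ ξ) (hε₀ : 0 ≤ ε) (hε : ε ≤ 1 / 4)
    (hv : 0 < v) (hμ : μ ≠ 0) (hvμ : v ≤ n * ‖μ‖ ^ 2) : Function.Injective (patchComb μ ξ) := by
  refine (injective_iff_map_eq_zero _).2 fun p hp ↦ norm_le_zero_iff.1 ?_
  have hsignal := h.abs_inner_signal_sub_le hε₀ (by linarith) hv hμ p
  have hnoise := h.abs_inner_noise_sub_le hε₀ (by linarith) hv hμ hvμ p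
  simp only [hp, inner_zero_left, zero_sub, abs_neg] at hsignal hnoise
  have hp' : ‖p‖ ≤ 3 * ε * ‖p‖ :=
    norm_prod_le_iff.2 ⟨hsignal, (pi_norm_le_iff_of_nonneg (by positivity)).2 hnoise⟩
  nlinarith [norm_nonneg p]

end NearlyOrthogonal
end NearlyOrthogonal

/-! ### Signal and noise coefficients along gradient descent -/

section Coefficients

variable {n m d : ℕ} {S : TrainingSet n d} {η : ℝ} {W₀ : Weights m d}

/-- The increment of the signal coefficient `γ_{j,r}` in one step of gradient descent from `W`. -/
noncomputable def signalStep (S : TrainingSet n d) (η : ℝ) (W : Weights m d) (j : ℤˣ)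
    (r : Fin m) : ℝ :=
  η / (n * m) * (‖S.signal‖ ^ 2 * ∑ i, -lossDeriv S W i *
    (reluDeriv (inner ℝ (W j r) (sgn (S.y i) • S.signal)) * (sgn (S.y i) * sgn (S.yObs i))))

/-- The increment of the noise coefficient `ρ_{j,r,i}` in one step of gradient descent from `W`. -/
noncomputable def noiseStep (S : TrainingSet n d) (η : ℝ) (W : Weights m d) (j : ℤˣ)
    (r : Fin m) (i : Fin n) : ℝ :=
  η / (n * m) * (‖S.noise i‖ ^ 2 * -lossDeriv S W i *
    (reluDeriv (inner ℝ (W j r) (S.noise i)) * (sgn j * sgn (S.yObs i))))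

lemma mul_inv_norm_sq_smul {E : Type*} [NormedAddCommGroup E] [NormedSpace ℝ E] {a b : ℝ} {x : E}
    (h : a = b * ‖x‖ ^ 2) : (a * (‖x‖ ^ 2)⁻¹) • x = b • x := by
  rcases eq_or_ne x 0 with rfl | hx
  · simp
  · rw [h, mul_inv_cancel_right₀ (by simpa using hx)]

lemma gdStep_eq (W : Weights m d) (j : ℤˣ) (r : Fin m) :
    gdStep S η W j r = W j r + patchComb S.signal S.noise
      (sgn j * signalStep S η W j r, noiseStep S η W j r) := by
  have hsignal : (sgn j * signalStep S η W j r * (‖S.signal‖ ^ 2)⁻¹) • S.signal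
      = -((η / ((n : ℝ) * m)) • ∑ i : Fin n,
        (lossDeriv S W i * reluDeriv (inner ℝ (W j r) (sgn (S.y i) • S.signal))
          * sgn j * sgn (S.y i) * sgn (S.yObs i)) • S.signal) := by
    rw [← Finset.sum_smul, smul_smul, ← neg_smul]
    refine mul_inv_norm_sq_smul ?_
    simp only [signalStep, Finset.mul_sum, Finset.sum_mul, ← Finset.sum_neg_distrib]
    exact Finset.sum_congr rfl fun i _ ↦ by ring
  have hnoise (i : Fin n) : (noiseStep S η W j r i * (‖S.noise i‖ ^ 2)⁻¹) • S.noise i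
      = -((η / ((n : ℝ) * m)) • (lossDeriv S W i * reluDeriv (inner ℝ (W j r) (S.noise i))
          * sgn j * sgn (S.yObs i)) • S.noise i) := by
    rw [smul_smul, ← neg_smul]
    exact mul_inv_norm_sq_smul (by rw [noiseStep]; ring)
  rw [gdStep, patchComb_apply, hsignal, Finset.sum_congr rfl fun i _ ↦ hnoise i,
    Finset.sum_neg_distrib, ← Finset.smul_sum]
  abel

variable (S η W₀) in
/-- The signal and noise coefficients of the gradient descent iterates, accumulated step by
step. -/
noncomputable def coeffIter : ℕ → Coeffs n m
  | 0 => ⟨0, 0⟩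
  | t + 1 =>
    { γ := (coeffIter t).γ + signalStep S η (gdIter S η W₀ t)
      ρ := (coeffIter t).ρ + noiseStep S η (gdIter S η W₀ t) }

lemma isDecomposition_iff {W : Weights m d} {c : Coeffs n m} :
    IsDecomposition S W₀ W c ↔
      ∀ j r, W j r = W₀ j r + patchComb S.signal S.noise (sgn j * c.γ j r, c.ρ j r) := by
  simp only [IsDecomposition, patchComb_apply, add_assoc]

lemma isDecomposition_coeffIter (t : ℕ) :
    IsDecomposition S W₀ (gdIter S η W₀ t) (coeffIter S η W₀ t) := by
  rw [isDecomposition_iff]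
  intro j r
  induction t with
  | zero =>
    have h0 : ((sgn j * (0 : ℝ), (0 : Fin n → ℝ)) : ℝ × (Fin n → ℝ)) = 0 := by simp
    simp only [gdIter, coeffIter, Pi.zero_apply, h0, map_zero, add_zero]
  | succ t ih =>
    simp only [gdIter, coeffIter]
    rw [gdStep_eq, ih, add_assoc, ← map_add, Prod.mk_add_mk, ← mul_add]
    rfl

lemma IsDecomposition.unique {W : Weights m d} {c c' : Coeffs n m}
    (hinj : Function.Injective (patchComb S.signal S.noise)) (hc : IsDecomposition S W₀ W c)
    (hc' : IsDecomposition S W₀ W c') : c = c' := by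
  have hpair (j : ℤˣ) (r : Fin m) : (sgn j * c.γ j r, c.ρ j r) = (sgn j * c'.γ j r, c'.ρ j r) :=
    hinj (add_left_cancel
      ((isDecomposition_iff.1 hc j r).symm.trans (isDecomposition_iff.1 hc' j r)))
  have hsgn (j : ℤˣ) : sgn j ≠ 0 := fun h ↦ by simpa [h] using sgn_mul_self j
  obtain ⟨γ, ρ⟩ := c
  obtain ⟨γ', ρ'⟩ := c'
  congr 1 <;> funext j r
  · exact mul_left_cancel₀ (hsgn j) (congrArg Prod.fst (hpair j r))
  · exact congrArg Prod.snd (hpair j r)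

lemma abs_reluDeriv_mul_sgn_le_one (x : ℝ) (a b : ℤˣ) :
    |reluDeriv x * (sgn a * sgn b)| ≤ 1 := by
  rw [abs_mul, abs_mul, abs_sgn, abs_sgn, one_mul, mul_one, abs_of_nonneg (reluDeriv_nonneg x)]
  exact reluDeriv_le_one x

lemma abs_signalStep_le (hη : 0 ≤ η) (W : Weights m d) (j : ℤˣ) (r : Fin m) :
    |signalStep S η W j r| ≤ η / (n * m) * (n * ‖S.signal‖ ^ 2) := by
  rw [signalStep, abs_mul, abs_mul, abs_of_nonneg (by positivity : 0 ≤ η / (n * m : ℝ)),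
    abs_of_nonneg (sq_nonneg ‖S.signal‖), mul_comm (n : ℝ) (‖S.signal‖ ^ 2)]
  gcongr
  refine (Finset.abs_sum_le_sum_abs _ _).trans
    ((Finset.sum_le_card_nsmul _ _ 1 fun i _ ↦ ?_).trans (by simp))
  rw [abs_mul, abs_of_nonneg (neg_lossDeriv_nonneg S W i)]
  exact mul_le_one₀ (neg_lossDeriv_le_one S W i) (abs_nonneg _)
    (abs_reluDeriv_mul_sgn_le_one _ _ _)

lemma abs_noiseStep_le (hη : 0 ≤ η) (W : Weights m d) (j : ℤˣ) (r : Fin m) (i : Fin n) :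
    |noiseStep S η W j r i| ≤ η / (n * m) * (‖S.noise i‖ ^ 2 * -lossDeriv S W i) := by
  have hℓ := neg_lossDeriv_nonneg S W i
  rw [noiseStep, abs_mul, abs_mul, abs_of_nonneg (by positivity : 0 ≤ η / (n * m : ℝ)),
    abs_of_nonneg (mul_nonneg (sq_nonneg _) hℓ)]
  refine mul_le_mul_of_nonneg_left ?_ (by positivity)
  exact mul_le_of_le_one_right (mul_nonneg (sq_nonneg _) hℓ) (abs_reluDeriv_mul_sgn_le_one _ _ _)

lemma noiseStep_yObs (W : Weights m d) (r : Fin m) (i : Fin n) :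
    noiseStep S η W (S.yObs i) r i = η / (n * m) * (‖S.noise i‖ ^ 2 * -lossDeriv S W i *
      reluDeriv (inner ℝ (W (S.yObs i) r) (S.noise i))) := by
  rw [noiseStep, sgn_mul_self, mul_one]

lemma coeffIter_ρ_yObs_nonneg (hη : 0 ≤ η) (t : ℕ) (r : Fin m) (i : Fin n) :
    0 ≤ (coeffIter S η W₀ t).ρ (S.yObs i) r i := by
  induction t with
  | zero => exact le_rfl
  | succ t ih =>
    refine add_nonneg ih ?_
    rw [noiseStep_yObs]
    have := neg_lossDeriv_nonneg S (gdIter S η W₀ t) i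
    have := reluDeriv_nonneg (inner ℝ (gdIter S η W₀ t (S.yObs i) r) (S.noise i))
    positivity

end Coefficients

/-! ### The first stage of training -/

section FirstStage

variable {n m d : ℕ}

/-- The initial weights are nearly orthogonal to the patches. -/
structure SmallInit (ε : ℝ) (μ : Patch d) (ξ : Fin n → Patch d) (W : Weights m d) : Prop where
  noise : ∀ j r i, |inner ℝ (W j r) (ξ i)| ≤ ε
  signal : ∀ j r, |inner ℝ (W j r) μ| ≤ ε

/-- In each class the clean labels outnumber the flipped ones by at least `b * n`. -/
def LabelMargin (b : ℝ) (y yObs : Fin n → ℤˣ) : Prop :=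
  ∀ a : ℤˣ, b * n ≤ ∑ i with y i = a, sgn (y i) * sgn (yObs i)

/-- Rescaled training time: the distance covered in `t` steps by a noise coefficient that grows at
unit loss derivative along a patch of squared norm `v`. -/
noncomputable def gdTime (n m : ℕ) (η v : ℝ) (t : ℕ) : ℝ := t * (η / (n * m) * v)

/-- Conditions under which the network outputs stay below `θ` during the first `T` steps of
gradient descent, so that every sample pulls on the weights with loss derivative about `-1 / 2`.
Here `v` is the squared norm of the noise patches, `κlo` and `κhi` bound `n ‖μ‖² / v`, and `ε` is
the error in near orthogonality. -/
structure FirstStage (ε v κlo κhi θ : ℝ) (S : TrainingSet n d) (η : ℝ) (W₀ : Weights m d)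
    (T : ℕ) : Prop where
  m_pos : 0 < m
  η_nonneg : 0 ≤ η
  ε_pos : 0 < ε
  v_pos : 0 < v
  θ_le : θ ≤ 1 / 8
  one_le_κlo : 1 ≤ κlo
  le_signal : κlo * v ≤ n * ‖S.signal‖ ^ 2
  signal_le : n * ‖S.signal‖ ^ 2 ≤ κhi * v
  ortho : NearlyOrthogonal ε v S.signal S.noise
  init : SmallInit ε S.signal S.noise W₀
  crosstalk : 12 * (ε * (κhi + 2)) ≤ 1
  small : gdTime n m η v T * (κhi + 2) + 4 * ε ≤ θ

section GdTime

variable {η v c : ℝ} {u : ℕ → ℝ} {T t : ℕ}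

lemma le_gdTime_mul (h₀ : u 0 ≤ 0) (h : ∀ t < T, u (t + 1) ≤ u t + η / (n * m) * (v * c))
    (ht : t ≤ T) : u t ≤ gdTime n m η v t * c := by
  induction t with
  | zero => simpa [gdTime] using h₀
  | succ t ih =>
    refine (h t ht).trans ((add_le_add_left (ih (Nat.le_of_succ_le ht)) _).trans_eq ?_)
    simp only [gdTime]
    push_cast
    ring

lemma abs_le_gdTime_mul (h₀ : u 0 = 0) (h : ∀ t, |u (t + 1) - u t| ≤ η / (n * m) * (v * c)) :
    |u t| ≤ gdTime n m η v t * c :=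
  le_gdTime_mul (u := fun t ↦ |u t|) (by simp [h₀])
    (fun t _ ↦ by linarith [abs_sub_abs_le_abs_sub (u (t + 1)) (u t), h t]) le_rfl

end GdTime

/-- Whatever the sign of `x`, the samples active for `x` contain a whole class. -/
lemma LabelMargin.le_sum_active {b : ℝ} {y yObs : Fin n → ℤˣ} (h : LabelMargin b y yObs)
    (hb : 0 ≤ b) (x : ℝ) :
    b * n ≤ ∑ i, reluDeriv (sgn (y i) * x) * (sgn (y i) * sgn (yObs i)) := by
  have hclass (a : ℤˣ) : 0 ≤ ∑ i with y i = a, sgn (y i) * sgn (yObs i) :=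
    (by positivity : 0 ≤ b * n).trans (h a)
  have hfib : ∑ i, reluDeriv (sgn (y i) * x) * (sgn (y i) * sgn (yObs i))
      = ∑ a : ℤˣ, reluDeriv (sgn a * x) * ∑ i with y i = a, sgn (y i) * sgn (yObs i) := by
    rw [← Finset.sum_fiberwise Finset.univ y]
    refine Finset.sum_congr rfl fun a _ ↦ ?_
    rw [Finset.mul_sum]
    exact Finset.sum_congr rfl fun i hi ↦ by rw [(Finset.mem_filter.1 hi).2]
  obtain ⟨a, ha⟩ : ∃ a : ℤˣ, 0 ≤ sgn a * x := by
    rcases le_total 0 x with hx | hx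
    · exact ⟨1, by simpa [sgn] using hx⟩
    · exact ⟨-1, by simpa [sgn] using hx⟩
  rw [hfib]
  refine (h a).trans (le_of_eq_of_le ?_ (Finset.single_le_sum
    (f := fun a ↦ reluDeriv (sgn a * x) * ∑ i with y i = a, sgn (y i) * sgn (yObs i))
    (fun a _ ↦ mul_nonneg (reluDeriv_nonneg _) (hclass a)) (Finset.mem_univ a)))
  simp only [reluDeriv, if_pos ha, one_mul]

namespace FirstStage

variable {S : TrainingSet n d} {η : ℝ} {W₀ : Weights m d} {ε v κlo κhi θ : ℝ} {T t : ℕ}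

lemma rate_nonneg (H : FirstStage ε v κlo κhi θ S η W₀ T) : 0 ≤ η / (n * m : ℝ) :=
  div_nonneg H.η_nonneg (by positivity)

lemma gdTime_nonneg (H : FirstStage ε v κlo κhi θ S η W₀ T) : 0 ≤ gdTime n m η v t :=
  mul_nonneg t.cast_nonneg (mul_nonneg H.rate_nonneg H.v_pos.le)

lemma gdTime_le (H : FirstStage ε v κlo κhi θ S η W₀ T) (ht : t ≤ T) :
    gdTime n m η v t ≤ gdTime n m η v T :=
  mul_le_mul_of_nonneg_right (by exact_mod_cast ht) (mul_nonneg H.rate_nonneg H.v_pos.le)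

lemma v_le (H : FirstStage ε v κlo κhi θ S η W₀ T) : v ≤ n * ‖S.signal‖ ^ 2 :=
  (le_mul_of_one_le_left H.v_pos.le H.one_le_κlo).trans H.le_signal

lemma signal_ne_zero (H : FirstStage ε v κlo κhi θ S η W₀ T) : S.signal ≠ 0 := fun h ↦ by
  simpa [h] using H.v_pos.trans_le H.v_le

lemma one_le_κhi (H : FirstStage ε v κlo κhi θ S η W₀ T) : 1 ≤ κhi :=
  le_of_mul_le_mul_right (by simpa using H.v_le.trans H.signal_le) H.v_pos

lemma gdTime_mul_le (H : FirstStage ε v κlo κhi θ S η W₀ T) (ht : t ≤ T) :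
    gdTime n m η v t * (κhi + 2) + 4 * ε ≤ θ := by
  have h := mul_le_mul_of_nonneg_right (H.gdTime_le ht)
    (show 0 ≤ κhi + 2 by linarith [H.one_le_κhi])
  linarith [H.small]

lemma four_mul_ε_le (H : FirstStage ε v κlo κhi θ S η W₀ T) : 4 * ε ≤ θ := by
  simpa [gdTime] using H.gdTime_mul_le T.zero_le

lemma noise_le (H : FirstStage ε v κlo κhi θ S η W₀ T) (i : Fin n) :
    ‖S.noise i‖ ^ 2 ≤ v * (1 + ε) := by
  linarith [(abs_le.1 (H.ortho.norm_sq i)).2]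

lemma le_noise (H : FirstStage ε v κlo κhi θ S η W₀ T) (i : Fin n) :
    v * (1 - ε) ≤ ‖S.noise i‖ ^ 2 := by
  linarith [(abs_le.1 (H.ortho.norm_sq i)).1]

lemma patchComb_injective (H : FirstStage ε v κlo κhi θ S η W₀ T) :
    Function.Injective (patchComb S.signal S.noise) :=
  H.ortho.patchComb_injective H.ε_pos.le (by linarith [H.four_mul_ε_le, H.θ_le]) H.v_pos
    H.signal_ne_zero H.v_le

lemma abs_γ_le (H : FirstStage ε v κlo κhi θ S η W₀ T) (j : ℤˣ) (r : Fin m) :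
    |(coeffIter S η W₀ t).γ j r| ≤ gdTime n m η v t * κhi := by
  refine abs_le_gdTime_mul (u := fun t ↦ (coeffIter S η W₀ t).γ j r) rfl fun t ↦ ?_
  simp only [coeffIter, Pi.add_apply, add_sub_cancel_left]
  refine (abs_signalStep_le H.η_nonneg _ j r).trans ?_
  exact mul_le_mul_of_nonneg_left (H.signal_le.trans_eq (mul_comm _ _)) H.rate_nonneg

lemma abs_ρ_le (H : FirstStage ε v κlo κhi θ S η W₀ T) (j : ℤˣ) (r : Fin m) (i : Fin n) :
    |(coeffIter S η W₀ t).ρ j r i| ≤ gdTime n m η v t * 2 := by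
  refine abs_le_gdTime_mul (u := fun t ↦ (coeffIter S η W₀ t).ρ j r i) rfl fun t ↦ ?_
  simp only [coeffIter, Pi.add_apply, add_sub_cancel_left]
  refine (abs_noiseStep_le H.η_nonneg _ j r i).trans (mul_le_mul_of_nonneg_left ?_ H.rate_nonneg)
  calc ‖S.noise i‖ ^ 2 * -lossDeriv S (gdIter S η W₀ t) i ≤ ‖S.noise i‖ ^ 2 :=
        mul_le_of_le_one_right (sq_nonneg _) (neg_lossDeriv_le_one _ _ _)
    _ ≤ v * (1 + ε) := H.noise_le i
    _ ≤ v * 2 := mul_le_mul_of_nonneg_left (by linarith [H.four_mul_ε_le, H.θ_le]) H.v_pos.le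

lemma norm_coeff_le (H : FirstStage ε v κlo κhi θ S η W₀ T) (j : ℤˣ) (r : Fin m) :
    ‖(sgn j * (coeffIter S η W₀ t).γ j r, (coeffIter S η W₀ t).ρ j r)‖
      ≤ gdTime n m η v t * (κhi + 2) := by
  have h₀ := H.gdTime_nonneg (t := t)
  have hκ := mul_nonneg h₀ (zero_le_one.trans H.one_le_κhi)
  have hγ := H.abs_γ_le (t := t) j r
  refine norm_prod_le_iff.2 ⟨?_, (pi_norm_le_iff_of_nonneg (by linarith)).2 fun i ↦ ?_⟩
  · rw [Real.norm_eq_abs, abs_mul, abs_sgn, one_mul]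
    linarith
  · rw [Real.norm_eq_abs]
    linarith [H.abs_ρ_le (t := t) j r i]

lemma gdIter_eq (j : ℤˣ) (r : Fin m) :
    gdIter S η W₀ t j r = W₀ j r + patchComb S.signal S.noise
      (sgn j * (coeffIter S η W₀ t).γ j r, (coeffIter S η W₀ t).ρ j r) :=
  isDecomposition_iff.1 (isDecomposition_coeffIter t) j r

lemma abs_inner_patchComb_noise_sub_le (H : FirstStage ε v κlo κhi θ S η W₀ T) (j : ℤˣ)
    (r : Fin m) (i : Fin n) :
    |inner ℝ (patchComb S.signal S.noise (sgn j * (coeffIter S η W₀ t).γ j r,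
        (coeffIter S η W₀ t).ρ j r)) (S.noise i) - (coeffIter S η W₀ t).ρ j r i|
      ≤ 3 * ε * (gdTime n m η v t * (κhi + 2)) := by
  have hε := H.ε_pos.le
  refine (H.ortho.abs_inner_noise_sub_le hε (by linarith [H.four_mul_ε_le, H.θ_le]) H.v_pos
    H.signal_ne_zero H.v_le _ i).trans ?_
  gcongr
  exact H.norm_coeff_le j r

lemma three_mul_ε_mul_le (H : FirstStage ε v κlo κhi θ S η W₀ T) (ht : t ≤ T) :
    3 * ε * (gdTime n m η v t * (κhi + 2)) ≤ ε := by
  have h := H.gdTime_mul_le ht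
  nlinarith [H.ε_pos.le, H.θ_le]

lemma abs_inner_noise_sub_le (H : FirstStage ε v κlo κhi θ S η W₀ T) (ht : t ≤ T) (j : ℤˣ)
    (r : Fin m) (i : Fin n) :
    |inner ℝ (gdIter S η W₀ t j r) (S.noise i) - (coeffIter S η W₀ t).ρ j r i| ≤ 2 * ε := by
  rw [gdIter_eq, inner_add_left, add_sub_assoc]
  refine (abs_add_le _ _).trans ?_
  linarith [H.init.noise j r i, H.abs_inner_patchComb_noise_sub_le (t := t) j r i,
    H.three_mul_ε_mul_le ht]

lemma abs_inner_signal_sub_le (H : FirstStage ε v κlo κhi θ S η W₀ T) (ht : t ≤ T) (j a : ℤˣ)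
    (r : Fin m) :
    |inner ℝ (gdIter S η W₀ t j r) (sgn a • S.signal)
      - sgn a * (sgn j * (coeffIter S η W₀ t).γ j r)| ≤ 2 * ε := by
  have hε := H.ε_pos.le
  have hcomb := H.ortho.abs_inner_signal_sub_le hε (by linarith [H.four_mul_ε_le, H.θ_le]) H.v_pos
    H.signal_ne_zero (sgn j * (coeffIter S η W₀ t).γ j r, (coeffIter S η W₀ t).ρ j r)
  have hnorm := mul_le_mul_of_nonneg_left (H.norm_coeff_le (t := t) j r)
    (by linarith : 0 ≤ 3 * ε)
  rw [inner_smul_right, ← mul_sub, abs_mul, abs_sgn, one_mul, gdIter_eq, inner_add_left,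
    add_sub_assoc]
  refine (abs_add_le _ _).trans ?_
  linarith [H.init.signal j r, H.three_mul_ε_mul_le ht]

lemma abs_network_le (H : FirstStage ε v κlo κhi θ S η W₀ T) (ht : t ≤ T) (i : Fin n) :
    |network (gdIter S η W₀ t) (S.input i)| ≤ θ := by
  have hs := H.gdTime_nonneg (t := t)
  have hκ := mul_nonneg hs (zero_le_one.trans H.one_le_κhi)
  have hε := H.ε_pos.le
  refine LabelNoiseCNN.abs_network_le H.m_pos fun j r ↦ le_trans (add_le_add
    (relu_le (b := gdTime n m η v t * κhi + 2 * ε) (by positivity) ?_)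
    (relu_le (b := gdTime n m η v t * 2 + 2 * ε) (by positivity) ?_))
    (by linarith [H.gdTime_mul_le ht])
  · have hγ : |sgn (S.y i) * (sgn j * (coeffIter S η W₀ t).γ j r)| ≤ gdTime n m η v t * κhi := by
      simpa only [abs_mul, abs_sgn, one_mul] using H.abs_γ_le j r
    simp only [TrainingSet.input]
    linarith [(abs_le.1 (H.abs_inner_signal_sub_le ht j (S.y i) r)).2, (abs_le.1 hγ).2]
  · simp only [TrainingSet.input]
    linarith [(abs_le.1 (H.abs_inner_noise_sub_le ht j r i)).2,
      (abs_le.1 (H.abs_ρ_le (t := t) j r i)).2]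

lemma abs_neg_lossDeriv_sub_half_le (H : FirstStage ε v κlo κhi θ S η W₀ T) (ht : t ≤ T)
    (i : Fin n) : |-lossDeriv S (gdIter S η W₀ t) i - 1 / 2| ≤ θ :=
  (LabelNoiseCNN.abs_neg_lossDeriv_sub_half_le S _ i).trans (H.abs_network_le ht i)

lemma ρ_le (H : FirstStage ε v κlo κhi θ S η W₀ T) (ht : t ≤ T) (j : ℤˣ) (r : Fin m)
    (i : Fin n) : (coeffIter S η W₀ t).ρ j r i ≤ gdTime n m η v t * (1 / 2 + 2 * θ) := by
  refine le_gdTime_mul (u := fun t ↦ (coeffIter S η W₀ t).ρ j r i) le_rfl (fun t ht ↦ ?_) ht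
  refine add_le_add le_rfl (((le_abs_self _).trans (abs_noiseStep_le H.η_nonneg _ j r i)).trans
    (mul_le_mul_of_nonneg_left ?_ H.rate_nonneg))
  have hε := H.ε_pos
  have hv := H.v_pos
  calc ‖S.noise i‖ ^ 2 * -lossDeriv S (gdIter S η W₀ t) i ≤ v * (1 + ε) * (1 / 2 + θ) :=
        mul_le_mul (H.noise_le i)
          (by linarith [(abs_le.1 (H.abs_neg_lossDeriv_sub_half_le ht.le i)).2])
          (neg_lossDeriv_nonneg _ _ _) (by positivity)
    _ = v * ((1 + ε) * (1 / 2 + θ)) := mul_assoc _ _ _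
    _ ≤ v * (1 / 2 + 2 * θ) :=
        mul_le_mul_of_nonneg_left (by nlinarith [H.four_mul_ε_le, H.θ_le]) hv.le

/-- The crosstalk between patches grows at a slower rate than the noise coefficients, so a neuron
that is active on a noise patch stays active. -/
lemma inner_noise_nonneg (H : FirstStage ε v κlo κhi θ S η W₀ T) {r : Fin m} {i : Fin n}
    (h₀ : 0 ≤ inner ℝ (W₀ (S.yObs i) r) (S.noise i))
    (hρ : gdTime n m η v t * (1 / 4) ≤ (coeffIter S η W₀ t).ρ (S.yObs i) r i) :
    0 ≤ inner ℝ (gdIter S η W₀ t (S.yObs i) r) (S.noise i) := by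
  have hcross : 3 * ε * (gdTime n m η v t * (κhi + 2)) ≤ gdTime n m η v t * (1 / 4) := by
    linarith [mul_le_mul_of_nonneg_left H.crosstalk (H.gdTime_nonneg (t := t))]
  rw [gdIter_eq, inner_add_left]
  linarith [(abs_le.1 (H.abs_inner_patchComb_noise_sub_le (t := t) (S.yObs i) r i)).1]

lemma le_ρ (H : FirstStage ε v κlo κhi θ S η W₀ T) (ht : t ≤ T) {r : Fin m} {i : Fin n}
    (h₀ : 0 ≤ inner ℝ (W₀ (S.yObs i) r) (S.noise i)) :
    gdTime n m η v t * (1 / 4) ≤ (coeffIter S η W₀ t).ρ (S.yObs i) r i := by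
  induction t with
  | zero => simp [gdTime, coeffIter]
  | succ t ih =>
    have hρ := ih (Nat.le_of_succ_le ht)
    have hstep : η / (n * m) * (v * (1 / 4)) ≤
        noiseStep S η (gdIter S η W₀ t) (S.yObs i) r i := by
      rw [noiseStep_yObs, reluDeriv, if_pos (H.inner_noise_nonneg h₀ hρ), mul_one]
      refine mul_le_mul_of_nonneg_left ?_ H.rate_nonneg
      have hε := H.four_mul_ε_le
      have hθ := H.θ_le
      calc v * (1 / 4) ≤ v * ((1 - ε) * (1 / 2 - θ)) :=
            mul_le_mul_of_nonneg_left (by nlinarith [H.ε_pos]) H.v_pos.le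
        _ = v * (1 - ε) * (1 / 2 - θ) := (mul_assoc _ _ _).symm
        _ ≤ ‖S.noise i‖ ^ 2 * -lossDeriv S (gdIter S η W₀ t) i :=
            mul_le_mul (H.le_noise i) (by linarith [(abs_le.1
              (H.abs_neg_lossDeriv_sub_half_le (Nat.le_of_succ_le ht) i)).1])
              (by linarith) (sq_nonneg _)
    refine le_trans (le_of_eq ?_) (add_le_add hρ hstep)
    simp only [gdTime]
    push_cast
    ring

lemma le_sum_loss (H : FirstStage ε v κlo κhi θ S η W₀ T) {b : ℝ} (hb : 0 ≤ b)
    (hbal : LabelMargin b S.y S.yObs) (ht : t ≤ T) (x : ℝ) :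
    n * (b / 2 - θ) ≤ ∑ i, -lossDeriv S (gdIter S η W₀ t) i *
      (reluDeriv (sgn (S.y i) * x) * (sgn (S.y i) * sgn (S.yObs i))) := by
  have hterm (i : Fin n) : 1 / 2 * (reluDeriv (sgn (S.y i) * x) * (sgn (S.y i) * sgn (S.yObs i)))
      - θ ≤ -lossDeriv S (gdIter S η W₀ t) i *
        (reluDeriv (sgn (S.y i) * x) * (sgn (S.y i) * sgn (S.yObs i))) := by
    have h := mul_le_mul (H.abs_neg_lossDeriv_sub_half_le ht i)
      (abs_reluDeriv_mul_sgn_le_one (sgn (S.y i) * x) (S.y i) (S.yObs i)) (abs_nonneg _)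
      (by linarith [H.four_mul_ε_le, H.ε_pos])
    rw [← abs_mul] at h
    linarith [(abs_le.1 h).1]
  refine le_trans ?_ (Finset.sum_le_sum fun i _ ↦ hterm i)
  rw [Finset.sum_sub_distrib, ← Finset.mul_sum, Finset.sum_const, Finset.card_univ,
    Fintype.card_fin, nsmul_eq_mul]
  linarith [hbal.le_sum_active hb x]

lemma le_γ (H : FirstStage ε v κlo κhi θ S η W₀ T) {b : ℝ} (hb : θ ≤ b / 2)
    (hbal : LabelMargin b S.y S.yObs) (ht : t ≤ T) (j : ℤˣ) (r : Fin m) :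
    gdTime n m η v t * (κlo * (b / 2 - θ)) ≤ (coeffIter S η W₀ t).γ j r := by
  have hb₀ : 0 ≤ b := by linarith [H.four_mul_ε_le, H.ε_pos]
  have hneg := le_gdTime_mul (n := n) (m := m) (η := η) (v := v) (c := -(κlo * (b / 2 - θ)))
    (u := fun t ↦ -(coeffIter S η W₀ t).γ j r) (T := T) (by simp [coeffIter]) (fun t ht ↦ ?_) ht
  · linarith
  · have hsum : v * (κlo * (b / 2 - θ)) ≤ ‖S.signal‖ ^ 2 * ∑ i, -lossDeriv S (gdIter S η W₀ t) i *
        (reluDeriv (inner ℝ (gdIter S η W₀ t j r) (sgn (S.y i) • S.signal))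
          * (sgn (S.y i) * sgn (S.yObs i))) := by
      simp only [inner_smul_right]
      calc v * (κlo * (b / 2 - θ)) = κlo * v * (b / 2 - θ) := by ring
        _ ≤ n * ‖S.signal‖ ^ 2 * (b / 2 - θ) :=
            mul_le_mul_of_nonneg_right H.le_signal (by linarith)
        _ = ‖S.signal‖ ^ 2 * (n * (b / 2 - θ)) := by ring
        _ ≤ _ := mul_le_mul_of_nonneg_left (H.le_sum_loss hb₀ hbal ht.le _) (sq_nonneg _)
    have hstep := mul_le_mul_of_nonneg_left hsum H.rate_nonneg
    simp only [coeffIter, Pi.add_apply, signalStep]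
    linarith

lemma sgn_y_mul_network_nonneg (H : FirstStage ε v κlo κhi θ S η W₀ T) (ht : t ≤ T) {i : Fin n}
    {R G : ℝ} (hR : 0 ≤ R) (hγ : ∀ j r, G ≤ (coeffIter S η W₀ t).γ j r)
    (hρ : ∀ j r, (coeffIter S η W₀ t).ρ j r i ≤ R) (hRG : R + 4 * ε ≤ G) :
    0 ≤ sgn (S.y i) * network (gdIter S η W₀ t) (S.input i) := by
  have hε := H.ε_pos
  have hsignal (j : ℤˣ) (r : Fin m) := abs_le.1 (H.abs_inner_signal_sub_le ht j (S.y i) r)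
  have haligned : G - 2 * ε ≤ branch (gdIter S η W₀ t) (S.y i) (S.input i) := by
    refine le_branch H.m_pos fun r ↦ ?_
    have h := (hsignal (S.y i) r).1
    rw [← mul_assoc, sgn_mul_self, one_mul] at h
    simp only [TrainingSet.input]
    linarith [hγ (S.y i) r, le_relu (inner ℝ (gdIter S η W₀ t (S.y i) r) (sgn (S.y i) • S.signal)),
      relu_nonneg (inner ℝ (gdIter S η W₀ t (S.y i) r) (S.noise i))]
  have hopposite : branch (gdIter S η W₀ t) (-S.y i) (S.input i) ≤ 0 + (R + 2 * ε) := by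
    refine branch_le H.m_pos fun r ↦
      add_le_add (relu_le le_rfl ?_) (relu_le (by positivity) ?_) <;> simp only [TrainingSet.input]
    · have h := (hsignal (-S.y i) r).2
      rw [sgn_neg, ← mul_assoc, mul_neg, sgn_mul_self, neg_one_mul] at h
      linarith [hγ (-S.y i) r]
    · linarith [hρ (-S.y i) r, (abs_le.1 (H.abs_inner_noise_sub_le ht (-S.y i) r i)).2]
  rw [sgn_mul_network]
  linarith

theorem stageOneOutcome (H : FirstStage ε v κlo κhi θ S η W₀ T) {b lo : ℝ} (hb : θ ≤ b / 2)
    (hbal : LabelMargin b S.y S.yObs) (hgap : 1 / 2 + 3 * θ ≤ κlo * (b / 2 - θ))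
    (hε : 4 * ε ≤ gdTime n m η v T * θ) (hlo : lo ≤ gdTime n m η v T * (1 / 4)) :
    StageOneOutcome lo 1 S η W₀ T := by
  have hs := H.gdTime_nonneg (t := T)
  have hκ := H.one_le_κhi
  have hε₀ := H.ε_pos
  have hθ : 0 < θ := by linarith [H.four_mul_ε_le]
  have hsκ : gdTime n m η v T * κhi ≤ 1 := by linarith [H.small, H.θ_le]
  have hγ (j : ℤˣ) (r : Fin m) :
      gdTime n m η v T * (1 / 2 + 3 * θ) ≤ (coeffIter S η W₀ T).γ j r :=
    (mul_le_mul_of_nonneg_left hgap hs).trans (H.le_γ hb hbal le_rfl j r)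
  have hρ := H.ρ_le le_rfl
  have hcorrect (i : Fin n) : 0 ≤ sgn (S.y i) * network (gdIter S η W₀ T) (S.input i) :=
    H.sgn_y_mul_network_nonneg le_rfl (by positivity) hγ (fun j r ↦ hρ j r i) (by linarith)
  have hunique (c : Coeffs n m) (hc : IsDecomposition S W₀ (gdIter S η W₀ T) c) :
      c = coeffIter S η W₀ T :=
    hc.unique H.patchComb_injective (isDecomposition_coeffIter T)
  have hρpos (r : Fin m) (i : Fin n) : (coeffIter S η W₀ T).ρpos (S.yObs i) r i
      = (coeffIter S η W₀ T).ρ (S.yObs i) r i :=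
    if_pos (coeffIter_ρ_yObs_nonneg H.η_nonneg T r i)
  refine ⟨⟨_, isDecomposition_coeffIter T, hunique⟩, fun c hc ↦ ?_, fun i hi ↦ ?_, fun i hi ↦ ?_⟩
  · obtain rfl := hunique c hc
    simp only [hρpos]
    refine ⟨fun i r h₀ ↦ ⟨hlo.trans (H.le_ρ le_rfl h₀), ?_⟩, fun j r ↦ ⟨?_, ?_⟩, fun j r r' i ↦ ?_⟩
    · nlinarith [hρ (S.yObs i) r i, H.θ_le]
    · nlinarith [hγ j r]
    · linarith [(abs_le.1 (H.abs_γ_le (t := T) j r)).2]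
    · linarith [hρ (S.yObs i) r' i, hγ j r]
  · rw [hi]
    exact hcorrect i
  · rw [Int.units_ne_iff_eq_neg.1 hi, sgn_neg]
    linarith [hcorrect i]

end FirstStage
end FirstStage

/-! ### Gaussian concentration -/

section Concentration

lemma measureReal_exists_le {Ω ι : Type*} [MeasurableSpace Ω] [Fintype ι] {P : Measure Ω}
    {p : ι → Ω → Prop} {b : ℝ} (h : ∀ i, P.real {ω | p i ω} ≤ b) :
    P.real {ω | ∃ i, p i ω} ≤ Fintype.card ι * b := by
  rw [Set.ofPred_exists]
  refine (measureReal_iUnion_fintype_le _).trans ((Finset.sum_le_sum fun i _ ↦ h i).trans_eq ?_)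
  rw [Finset.sum_const, Finset.card_univ, nsmul_eq_mul]

lemma prod_real_le {α β : Type*} [MeasurableSpace α] [MeasurableSpace β] {P : Measure α}
    {Q : Measure β} [IsFiniteMeasure P] [IsProbabilityMeasure Q] {s : Set (α × β)}
    (hs : MeasurableSet s) {b : ℝ} (h : ∀ y, P.real ((fun x ↦ (x, y)) ⁻¹' s) ≤ b) :
    (P.prod Q).real s ≤ b := by
  obtain ⟨y₀⟩ := Q.nonempty_of_neZero
  refine ENNReal.toReal_le_of_le_ofReal (measureReal_nonneg.trans (h y₀)) ?_
  rw [Measure.prod_apply_symm hs]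
  calc ∫⁻ y, P ((fun x ↦ (x, y)) ⁻¹' s) ∂Q ≤ ∫⁻ _, ENNReal.ofReal b ∂Q :=
        lintegral_mono fun y ↦
          (ENNReal.le_ofReal_iff_toReal_le (measure_ne_top _ _)
            (measureReal_nonneg.trans (h y₀))).2 (h y)
    _ = ENNReal.ofReal b := by rw [lintegral_const, measure_univ, mul_one]

lemma measureReal_lt_abs_le {Ω : Type*} [MeasurableSpace Ω] {P : Measure Ω} [IsFiniteMeasure P]
    {X : Ω → ℝ} {c : NNReal} (h : HasSubgaussianMGF X c P) {t : ℝ} (ht : 0 ≤ t) :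
    P.real {ω | t < |X ω|} ≤ 2 * Real.exp (-t ^ 2 / (2 * c)) := by
  have hsubset : {ω | t < |X ω|} ⊆ {ω | t ≤ X ω} ∪ {ω | t ≤ (-X) ω} := fun ω hω ↦
    (lt_abs.1 (show t < |X ω| from hω)).imp le_of_lt le_of_lt
  calc P.real {ω | t < |X ω|} ≤ P.real {ω | t ≤ X ω} + P.real {ω | t ≤ (-X) ω} :=
        (measureReal_mono hsubset).trans (measureReal_union_le _ _)
    _ ≤ 2 * Real.exp (-t ^ 2 / (2 * c)) := by
        rw [two_mul]
        exact add_le_add (h.measure_ge_le ht) (h.neg.measure_ge_le ht)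

variable {d : ℕ} {σ t Q : ℝ}

instance isProbabilityMeasure_isoGaussian (d : ℕ) (σ : ℝ) :
    IsProbabilityMeasure (isoGaussian d σ) :=
  Measure.isProbabilityMeasure_map (by fun_prop)

lemma measurableSet_lt_abs_inner (t : ℝ) (v : Patch d) :
    MeasurableSet {x : Patch d | t < |inner ℝ x v|} :=
  measurableSet_lt (by fun_prop) (by fun_prop)

lemma measurableSet_norm_sq_le_and_lt_abs_inner (Q t : ℝ) :
    MeasurableSet {p : Patch d × Patch d | ‖p.2‖ ^ 2 ≤ Q ∧ t < |inner ℝ p.1 p.2|} :=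
  (measurableSet_le (f := fun p : Patch d × Patch d ↦ ‖p.2‖ ^ 2) (by fun_prop)
    measurable_const).inter
  (measurableSet_lt (g := fun p : Patch d × Patch d ↦ |inner ℝ p.1 p.2|) measurable_const
    (by fun_prop))

lemma isoGaussian_map_inner (σ : ℝ) (v : Patch d) :
    (isoGaussian d σ).map (fun x ↦ inner ℝ x v) = gaussianReal 0 (‖σ • v‖ ^ 2).toNNReal := by
  have h := IsGaussian.map_eq_gaussianReal (μ := stdGaussian (Patch d)) (innerSL ℝ (σ • v))
  rw [integral_strongDual_stdGaussian, variance_dual_stdGaussian, innerSL_apply_norm] at h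
  rw [isoGaussian, Measure.map_map (by fun_prop) (by fun_prop), ← h]
  congr 1
  funext x
  simp only [Function.comp_apply, innerSL_apply_apply, inner_smul_left, inner_smul_right,
    real_inner_comm, conj_trivial]

lemma hasSubgaussianMGF_inner_isoGaussian {v : Patch d} (hv : ‖v‖ ^ 2 ≤ Q) :
    HasSubgaussianMGF (fun x ↦ inner ℝ x v) (σ ^ 2 * Q).toNNReal (isoGaussian d σ) where
  integrable_exp_mul s := by
    have h := integrable_exp_mul_gaussianReal (μ := 0) (v := (‖σ • v‖ ^ 2).toNNReal) s
    rw [← isoGaussian_map_inner] at h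
    exact h.comp_measurable (by fun_prop)
  mgf_le s := by
    have hvar : ‖σ • v‖ ^ 2 ≤ σ ^ 2 * Q := by
      rw [norm_smul, mul_pow, Real.norm_eq_abs, sq_abs]
      gcongr
    rw [mgf_gaussianReal (isoGaussian_map_inner σ v), zero_mul, zero_add]
    gcongr

lemma isoGaussian_real_lt_abs_inner_le {v : Patch d} (hv : ‖v‖ ^ 2 ≤ Q) (ht : 0 ≤ t) :
    (isoGaussian d σ).real {x | t < |inner ℝ x v|}
      ≤ 2 * Real.exp (-t ^ 2 / (2 * (σ ^ 2 * Q))) := by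
  have h := measureReal_lt_abs_le (hasSubgaussianMGF_inner_isoGaussian (σ := σ) hv) ht
  rwa [Real.coe_toNNReal _ (mul_nonneg (sq_nonneg σ) ((sq_nonneg ‖v‖).trans hv))] at h

lemma prod_isoGaussian_real_lt_abs_inner_le {ν : Measure (Patch d)} [IsProbabilityMeasure ν]
    (ht : 0 ≤ t) :
    ((isoGaussian d σ).prod ν).real {p | ‖p.2‖ ^ 2 ≤ Q ∧ t < |inner ℝ p.1 p.2|}
      ≤ 2 * Real.exp (-t ^ 2 / (2 * (σ ^ 2 * Q))) := by
  refine prod_real_le (measurableSet_norm_sq_le_and_lt_abs_inner Q t) fun y ↦ ?_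
  by_cases hy : ‖y‖ ^ 2 ≤ Q
  · exact (measureReal_mono fun x hx ↦ hx.2).trans (isoGaussian_real_lt_abs_inner_le hy ht)
  · simpa only [Set.preimage_ofPred_eq, hy, false_and, Set.ofPred_false, measureReal_empty]
      using by positivity

lemma neg_sub_two_mul_sq_le_log {u : ℝ} (hu : u ≤ 1 / 2) :
    -u - 2 * u ^ 2 ≤ Real.log (1 - u) := by
  have h₁ : 0 < 1 - u := by linarith
  have hdiff : 1 - (1 - u)⁻¹ - (-u - 2 * u ^ 2) = u ^ 2 * (1 - 2 * u) / (1 - u) := by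
    field_simp
    ring
  have hnonneg : 0 ≤ u ^ 2 * (1 - 2 * u) / (1 - u) :=
    div_nonneg (mul_nonneg (sq_nonneg _) (by linarith)) h₁.le
  linarith [Real.one_sub_inv_le_log_of_pos h₁]

lemma integral_exp_mul_sq_gaussianReal {l : ℝ} (hl : l < 1 / 2) :
    ∫ x, Real.exp (l * x ^ 2) ∂gaussianReal 0 1 = √(1 / (1 - 2 * l)) := by
  have hdensity (x : ℝ) : gaussianPDFReal 0 1 x • Real.exp (l * x ^ 2)
      = (√(2 * Real.pi))⁻¹ * Real.exp (-(1 / 2 - l) * x ^ 2) := by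
    simp only [gaussianPDFReal, NNReal.coe_one, mul_one, sub_zero, smul_eq_mul]
    rw [mul_assoc, ← Real.exp_add]
    congr 2
    ring
  rw [integral_gaussianReal_eq_integral_smul one_ne_zero]
  simp_rw [hdensity]
  rw [integral_const_mul, integral_gaussian, ← Real.sqrt_inv, ← Real.sqrt_mul (by positivity)]
  congr 1
  have h₁ : 1 - 2 * l ≠ 0 := by linarith
  have h₂ : 1 / 2 - l ≠ 0 := by linarith
  field_simp [h₁, h₂]

lemma integrable_exp_mul_sq_gaussianReal {l : ℝ} (hl : l < 1 / 2) :
    Integrable (fun x ↦ Real.exp (l * x ^ 2)) (gaussianReal 0 1) := by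
  refine Integrable.of_integral_ne_zero ?_
  rw [integral_exp_mul_sq_gaussianReal hl]
  have h : 0 < 1 - 2 * l := by linarith
  positivity

lemma integral_exp_mul_sq_gaussianReal_le {l : ℝ} (hl : l ≤ 1 / 4) :
    ∫ x, Real.exp (l * x ^ 2) ∂gaussianReal 0 1 ≤ Real.exp (l + 4 * l ^ 2) := by
  have h₀ : 0 < 1 - 2 * l := by linarith
  have hlog := neg_sub_two_mul_sq_le_log (u := 2 * l) (by linarith)
  rw [integral_exp_mul_sq_gaussianReal (by linarith), Real.sqrt_le_left (Real.exp_pos _).le,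
    ← Real.exp_nat_mul, one_div, ← Real.exp_log h₀, ← Real.exp_neg, Real.exp_le_exp]
  push_cast
  linarith

lemma exp_mul_sum_sq (l : ℝ) (x : Fin d → ℝ) :
    Real.exp (l * ∑ i, x i ^ 2) = ∏ i, Real.exp (l * x i ^ 2) := by
  rw [Finset.mul_sum, Real.exp_sum]

lemma integrable_exp_mul_sum_sq {l : ℝ} (hl : l < 1 / 2) :
    Integrable (fun x : Fin d → ℝ ↦ Real.exp (l * ∑ i, x i ^ 2))
      (Measure.pi fun _ ↦ gaussianReal 0 1) := by
  simp only [exp_mul_sum_sq]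
  exact Integrable.fintype_prod fun _ ↦ integrable_exp_mul_sq_gaussianReal hl

lemma mgf_sum_sq_le {l : ℝ} (hl : l ≤ 1 / 4) :
    mgf (fun x : Fin d → ℝ ↦ ∑ i, x i ^ 2) (Measure.pi fun _ ↦ gaussianReal 0 1) l
      ≤ Real.exp (d * (l + 4 * l ^ 2)) := by
  simp only [mgf, exp_mul_sum_sq]
  rw [integral_fintype_prod_eq_prod (fun _ : Fin d ↦ fun x : ℝ ↦ Real.exp (l * x ^ 2)),
    Finset.prod_const, Finset.card_univ, Fintype.card_fin, Real.exp_nat_mul]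
  exact pow_le_pow_left₀ (integral_nonneg fun x ↦ (Real.exp_pos _).le)
    (integral_exp_mul_sq_gaussianReal_le hl) _

lemma pi_gaussianReal_real_lt_abs_sum_sq_sub_le {ε : ℝ} (hε₀ : 0 ≤ ε) (hε : ε ≤ 1) :
    (Measure.pi fun _ : Fin d ↦ gaussianReal 0 1).real {x | ε * d < |∑ i, x i ^ 2 - d|}
      ≤ 2 * Real.exp (-(ε ^ 2 * d / 16)) := by
  set P := Measure.pi fun _ : Fin d ↦ gaussianReal 0 1
  have hupper : P.real {x | (1 + ε) * d ≤ ∑ i, x i ^ 2} ≤ Real.exp (-(ε ^ 2 * d / 16)) := by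
    refine (measure_ge_le_exp_mul_mgf _ (by linarith : 0 ≤ ε / 8)
      (integrable_exp_mul_sum_sq (by linarith))).trans
      ((mul_le_mul_of_nonneg_left (mgf_sum_sq_le (by linarith)) (Real.exp_pos _).le).trans_eq ?_)
    rw [← Real.exp_add]
    ring_nf
  have hlower : P.real {x | ∑ i, x i ^ 2 ≤ (1 - ε) * d} ≤ Real.exp (-(ε ^ 2 * d / 16)) := by
    refine (measure_le_le_exp_mul_mgf _ (by linarith : -(ε / 8) ≤ 0)
      (integrable_exp_mul_sum_sq (by linarith))).trans
      ((mul_le_mul_of_nonneg_left (mgf_sum_sq_le (by linarith)) (Real.exp_pos _).le).trans_eq ?_)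
    rw [← Real.exp_add]
    ring_nf
  have hsubset : {x : Fin d → ℝ | ε * d < |∑ i, x i ^ 2 - d|}
      ⊆ {x | (1 + ε) * d ≤ ∑ i, x i ^ 2} ∪ {x | ∑ i, x i ^ 2 ≤ (1 - ε) * d} := fun x hx ↦
    (lt_abs.1 (show ε * d < |∑ i, x i ^ 2 - d| from hx)).imp
      (fun h ↦ show (1 + ε) * d ≤ ∑ i, x i ^ 2 by linarith)
      (fun h ↦ show ∑ i, x i ^ 2 ≤ (1 - ε) * d by linarith)
  rw [two_mul]
  exact (measureReal_mono hsubset).trans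
    ((measureReal_union_le _ _).trans (add_le_add hupper hlower))

lemma isoGaussian_real_lt_abs_norm_sq_sub_le {ε : ℝ} (hσ : σ ≠ 0) (hε₀ : 0 ≤ ε) (hε : ε ≤ 1) :
    (isoGaussian d σ).real {x | ε * (σ ^ 2 * d) < |‖x‖ ^ 2 - σ ^ 2 * d|}
      ≤ 2 * Real.exp (-(ε ^ 2 * d / 16)) := by
  have hmeas : MeasurableSet {x : Patch d | ε * (σ ^ 2 * d) < |‖x‖ ^ 2 - σ ^ 2 * d|} :=
    measurableSet_lt (by fun_prop) (by fun_prop)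
  have hσ₂ : 0 < σ ^ 2 := by positivity
  rw [isoGaussian, ← map_pi_eq_stdGaussian, Measure.map_map (by fun_prop) (by fun_prop),
    map_measureReal_apply (by fun_prop) hmeas]
  refine (measureReal_mono fun x hx ↦ ?_).trans
    (pi_gaussianReal_real_lt_abs_sum_sq_sub_le (d := d) hε₀ hε)
  simp only [Set.mem_preimage, Function.comp_apply, Set.mem_ofPred_eq, EuclideanSpace.norm_sq_eq,
    Real.norm_eq_abs, sq_abs, PiLp.smul_apply, smul_eq_mul, mul_pow, ← Finset.mul_sum] at hx ⊢
  rw [← mul_sub, abs_mul, abs_of_pos hσ₂, mul_left_comm] at hx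
  exact lt_of_mul_lt_mul_left hx hσ₂.le

end Concentration

/-! ### Good events -/

section GoodEvents

variable {n m d : ℕ} {σξ σ0 : ℝ}

instance isProbabilityMeasure_noiseInitLaw :
    IsProbabilityMeasure (noiseInitLaw n m d σξ σ0) :=
  inferInstanceAs (IsProbabilityMeasure (Measure.prod _ _))

lemma measurePreserving_noise (i : Fin n) :
    MeasurePreserving (fun ω : (Fin n → Patch d) × Weights m d ↦ ω.1 i)
      (noiseInitLaw n m d σξ σ0) (isoGaussian d σξ) :=
  (measurePreserving_eval (fun _ ↦ isoGaussian d σξ) i).comp measurePreserving_fst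

lemma measurePreserving_weight (j : ℤˣ) (r : Fin m) :
    MeasurePreserving (fun W : Weights m d ↦ W j r)
      (Measure.pi fun _ ↦ Measure.pi fun _ ↦ isoGaussian d σ0) (isoGaussian d σ0) :=
  (measurePreserving_eval (fun _ ↦ isoGaussian d σ0) r).comp
    (measurePreserving_eval (fun _ ↦ Measure.pi fun _ ↦ isoGaussian d σ0) j)

lemma measurePreserving_init (j : ℤˣ) (r : Fin m) :
    MeasurePreserving (fun ω : (Fin n → Patch d) × Weights m d ↦ ω.2 j r)
      (noiseInitLaw n m d σξ σ0) (isoGaussian d σ0) :=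
  (measurePreserving_weight j r).comp measurePreserving_snd

lemma measurePreserving_noise_noise {i k : Fin n} (hik : i ≠ k) :
    MeasurePreserving (fun ω : (Fin n → Patch d) × Weights m d ↦ (ω.1 i, ω.1 k))
      (noiseInitLaw n m d σξ σ0) ((isoGaussian d σξ).prod (isoGaussian d σξ)) := by
  have hindep := (iIndepFun_pi (μ := fun _ : Fin n ↦ isoGaussian d σξ) (X := fun _ x ↦ x)
    fun _ ↦ aemeasurable_id').indepFun hik
  have hpair : MeasurePreserving (fun x : Fin n → Patch d ↦ (x i, x k))
      (Measure.pi fun _ ↦ isoGaussian d σξ) ((isoGaussian d σξ).prod (isoGaussian d σξ)) := by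
    refine ⟨by fun_prop, ?_⟩
    rw [hindep.map_prod_eq_prod_map_map (measurable_pi_apply i).aemeasurable
        (measurable_pi_apply k).aemeasurable,
      (measurePreserving_eval (fun _ ↦ isoGaussian d σξ) i).map_eq,
      (measurePreserving_eval (fun _ ↦ isoGaussian d σξ) k).map_eq]
  exact hpair.comp measurePreserving_fst

lemma measurePreserving_init_noise (j : ℤˣ) (r : Fin m) (i : Fin n) :
    MeasurePreserving (fun ω : (Fin n → Patch d) × Weights m d ↦ (ω.2 j r, ω.1 i))
      (noiseInitLaw n m d σξ σ0) ((isoGaussian d σ0).prod (isoGaussian d σξ)) :=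
  Measure.measurePreserving_swap.comp
    ((measurePreserving_eval (fun _ ↦ isoGaussian d σξ) i).prod (measurePreserving_weight j r))

lemma two_mul_exp_neg_sq_div_le {s t a : ℝ} (hs : 0 < s) (h : s * a ≤ t ^ 2) :
    2 * Real.exp (-t ^ 2 / s) ≤ 2 * Real.exp (-a) := by
  rw [neg_div]
  gcongr
  rwa [le_div_iff₀' hs]

variable {ε t Q a : ℝ} {μ : Patch d}

lemma noise_norm_sq_failure_le (hσξ : σξ ≠ 0) (hε₀ : 0 ≤ ε) (hε : ε ≤ 1)
    (ha : 16 * a ≤ ε ^ 2 * d) :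
    (noiseInitLaw n m d σξ σ0).real
        {ω | ∃ i, ε * (σξ ^ 2 * d) < |‖ω.1 i‖ ^ 2 - σξ ^ 2 * d|} ≤ n * (2 * Real.exp (-a)) := by
  refine (measureReal_exists_le (b := 2 * Real.exp (-a)) fun i ↦ ?_).trans_eq (by simp)
  have hmeas : MeasurableSet {x : Patch d | ε * (σξ ^ 2 * d) < |‖x‖ ^ 2 - σξ ^ 2 * d|} :=
    measurableSet_lt (by fun_prop) (by fun_prop)
  refine ((measurePreserving_noise i).measureReal_preimage hmeas.nullMeasurableSet).trans_le
    ((isoGaussian_real_lt_abs_norm_sq_sub_le hσξ hε₀ hε).trans ?_)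
  gcongr
  linarith

lemma noise_noise_failure_le (hσξ : σξ ≠ 0) (hQ : 0 < Q) (ht : 0 ≤ t)
    (ha : 2 * (σξ ^ 2 * Q) * a ≤ t ^ 2) :
    (noiseInitLaw n m d σξ σ0).real {ω | ∃ p : Fin n × Fin n, p.1 ≠ p.2 ∧
      ‖ω.1 p.2‖ ^ 2 ≤ Q ∧ t < |inner ℝ (ω.1 p.1) (ω.1 p.2)|} ≤ n ^ 2 * (2 * Real.exp (-a)) := by
  refine (measureReal_exists_le (b := 2 * Real.exp (-a)) fun p ↦ ?_).trans_eq (by simp [sq])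
  by_cases hp : p.1 = p.2
  · simpa only [hp, ne_eq, not_true_eq_false, false_and, Set.ofPred_false, measureReal_empty]
      using by positivity
  · calc (noiseInitLaw n m d σξ σ0).real _
        ≤ ((isoGaussian d σξ).prod (isoGaussian d σξ)).real
            {q | ‖q.2‖ ^ 2 ≤ Q ∧ t < |inner ℝ q.1 q.2|} :=
          (measureReal_mono fun ω hω ↦ hω.2).trans_eq
            ((measurePreserving_noise_noise hp).measureReal_preimage
              (measurableSet_norm_sq_le_and_lt_abs_inner Q t).nullMeasurableSet)
      _ ≤ 2 * Real.exp (-a) := (prod_isoGaussian_real_lt_abs_inner_le ht).trans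
          (two_mul_exp_neg_sq_div_le (by positivity) ha)

lemma noise_signal_failure_le (hσξ : σξ ≠ 0) (hQ : 0 < Q) (hμ : ‖μ‖ ^ 2 ≤ Q) (ht : 0 ≤ t)
    (ha : 2 * (σξ ^ 2 * Q) * a ≤ t ^ 2) :
    (noiseInitLaw n m d σξ σ0).real {ω | ∃ i, t < |inner ℝ (ω.1 i) μ|}
      ≤ n * (2 * Real.exp (-a)) := by
  refine (measureReal_exists_le (b := 2 * Real.exp (-a)) fun i ↦ ?_).trans_eq (by simp)
  exact ((measurePreserving_noise i).measureReal_preimage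
    (measurableSet_lt_abs_inner t μ).nullMeasurableSet).trans_le
    ((isoGaussian_real_lt_abs_inner_le hμ ht).trans
      (two_mul_exp_neg_sq_div_le (by positivity) ha))

lemma init_noise_failure_le (hσ0 : σ0 ≠ 0) (hQ : 0 < Q) (ht : 0 ≤ t)
    (ha : 2 * (σ0 ^ 2 * Q) * a ≤ t ^ 2) :
    (noiseInitLaw n m d σξ σ0).real {ω | ∃ p : ℤˣ × Fin m × Fin n,
      ‖ω.1 p.2.2‖ ^ 2 ≤ Q ∧ t < |inner ℝ (ω.2 p.1 p.2.1) (ω.1 p.2.2)|}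
      ≤ 2 * (m * n) * (2 * Real.exp (-a)) := by
  refine (measureReal_exists_le (b := 2 * Real.exp (-a)) fun p ↦ ?_).trans_eq (by simp)
  exact ((measurePreserving_init_noise p.1 p.2.1 p.2.2).measureReal_preimage
    (measurableSet_norm_sq_le_and_lt_abs_inner Q t).nullMeasurableSet).trans_le
    ((prod_isoGaussian_real_lt_abs_inner_le ht).trans
      (two_mul_exp_neg_sq_div_le (by positivity) ha))

lemma init_signal_failure_le (hσ0 : σ0 ≠ 0) (hQ : 0 < Q) (hμ : ‖μ‖ ^ 2 ≤ Q) (ht : 0 ≤ t)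
    (ha : 2 * (σ0 ^ 2 * Q) * a ≤ t ^ 2) :
    (noiseInitLaw n m d σξ σ0).real {ω | ∃ p : ℤˣ × Fin m, t < |inner ℝ (ω.2 p.1 p.2) μ|}
      ≤ 2 * m * (2 * Real.exp (-a)) := by
  refine (measureReal_exists_le (b := 2 * Real.exp (-a)) fun p ↦ ?_).trans_eq (by simp)
  exact ((measurePreserving_init p.1 p.2).measureReal_preimage
    (measurableSet_lt_abs_inner t μ).nullMeasurableSet).trans_le
    ((isoGaussian_real_lt_abs_inner_le hμ ht).trans
      (two_mul_exp_neg_sq_div_le (by positivity) ha))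

variable {κ : ℝ}

lemma not_nearlyOrthogonal_le (hn : 2 ≤ n) (hd : 0 < d) (hσξ : σξ ≠ 0) (hε₀ : 0 ≤ ε)
    (hε : ε ≤ 1) (hκ : 1 ≤ κ) (ha₀ : 0 ≤ a) (hμ : n * ‖μ‖ ^ 2 ≤ κ * (σξ ^ 2 * d))
    (ha : 4 * κ * n ^ 2 * a ≤ ε ^ 2 * d) :
    (noiseInitLaw n m d σξ σ0).real {ω | ¬ NearlyOrthogonal ε (σξ ^ 2 * d) μ ω.1}
      ≤ (n ^ 2 + 2 * n) * (2 * Real.exp (-a)) := by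
  set v := σξ ^ 2 * d
  have hn₂ : (2 : ℝ) ≤ n := by exact_mod_cast hn
  have hn₀ : (0 : ℝ) < n := by linarith
  have hv : 0 < v := by positivity
  have hrescale {q : ℝ} (hq : q ≤ 2 * κ) : 2 * (σξ ^ 2 * (q * v)) * a ≤ (ε * v / n) ^ 2 := by
    rw [div_pow, le_div_iff₀ (by positivity)]
    calc 2 * (σξ ^ 2 * (q * v)) * a * n ^ 2 = σξ ^ 2 * v * (2 * q * n ^ 2 * a) := by ring
      _ ≤ σξ ^ 2 * v * (2 * (2 * κ) * n ^ 2 * a) := by gcongr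
      _ = σξ ^ 2 * v * (4 * κ * n ^ 2 * a) := by ring
      _ ≤ σξ ^ 2 * v * (ε ^ 2 * d) := by gcongr
      _ = (ε * v) ^ 2 := by ring
  have ha_norm : 16 * a ≤ ε ^ 2 * d := by
    refine le_trans ?_ ha
    gcongr
    nlinarith
  have hμ_sq : ‖μ‖ ^ 2 ≤ κ * v := by nlinarith [sq_nonneg ‖μ‖]
  have hsubset : {ω : (Fin n → Patch d) × Weights m d | ¬ NearlyOrthogonal ε v μ ω.1}
      ⊆ {ω | ∃ i, ε * v < |‖ω.1 i‖ ^ 2 - v|}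
        ∪ ({ω | ∃ p : Fin n × Fin n, p.1 ≠ p.2 ∧
            ‖ω.1 p.2‖ ^ 2 ≤ 2 * v ∧ ε * v / n < |inner ℝ (ω.1 p.1) (ω.1 p.2)|}
        ∪ {ω | ∃ i, ε * v / n < |inner ℝ (ω.1 i) μ|}) := by
    intro ω hω
    by_contra hgood
    simp only [Set.mem_union, Set.mem_ofPred_eq, not_or, not_exists, not_and, not_lt,
      Prod.forall, le_div_iff₀' hn₀] at hgood
    obtain ⟨hnorm, hnoise, hsignal⟩ := hgood
    exact hω ⟨hnorm, fun i k hik ↦ hnoise i k hik (by nlinarith [(abs_le.1 (hnorm k)).2]), hsignal⟩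
  calc _ ≤ n * (2 * Real.exp (-a)) + (n ^ 2 * (2 * Real.exp (-a)) + n * (2 * Real.exp (-a))) :=
        (measureReal_mono hsubset).trans <| (measureReal_union_le _ _).trans <|
          add_le_add (noise_norm_sq_failure_le hσξ hε₀ hε ha_norm) <|
          (measureReal_union_le _ _).trans <| add_le_add
            (noise_noise_failure_le hσξ (mul_pos two_pos hv) (by positivity)
              (hrescale (by linarith)))
            (noise_signal_failure_le hσξ (by positivity) hμ_sq (by positivity)
              (hrescale (by linarith)))
    _ = (n ^ 2 + 2 * n) * (2 * Real.exp (-a)) := by ring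

lemma nearlyOrthogonal_and_not_smallInit_le (hn : 0 < n) (hd : 0 < d) (hσξ : σξ ≠ 0)
    (hσ0 : σ0 ≠ 0) (hε₀ : 0 ≤ ε) (hε : ε ≤ 1) (hκ : 1 ≤ κ) (ha₀ : 0 ≤ a)
    (hμ : n * ‖μ‖ ^ 2 ≤ κ * (σξ ^ 2 * d)) (ha : 4 * κ * n * a ≤ ε ^ 2 * d)
    (hinit : σ0 ^ 2 * (σξ ^ 2 * d) * d ≤ n) :
    (noiseInitLaw n m d σξ σ0).real
        {ω | NearlyOrthogonal ε (σξ ^ 2 * d) μ ω.1 ∧ ¬ SmallInit ε μ ω.1 ω.2}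
      ≤ 2 * (m * n + m) * (2 * Real.exp (-a)) := by
  set v := σξ ^ 2 * d
  have hn₁ : (1 : ℝ) ≤ n := by exact_mod_cast hn
  have hd₀ : (0 : ℝ) < d := by exact_mod_cast hd
  have hv : 0 < v := by positivity
  have hrescale {q : ℝ} (hq : q ≤ 2 * κ) : 2 * (σ0 ^ 2 * (q * v)) * a ≤ ε ^ 2 := by
    refine le_of_mul_le_mul_right ?_ hd₀
    calc 2 * (σ0 ^ 2 * (q * v)) * a * d = 2 * q * (σ0 ^ 2 * v * d) * a := by ring
      _ ≤ 2 * (2 * κ) * n * a := mul_le_mul_of_nonneg_right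
          (mul_le_mul (by linarith) hinit (by positivity) (by linarith)) ha₀
      _ = 4 * κ * n * a := by ring
      _ ≤ ε ^ 2 * d := ha
  have hμ_sq : ‖μ‖ ^ 2 ≤ κ * v := by nlinarith [sq_nonneg ‖μ‖]
  have hsubset : {ω : (Fin n → Patch d) × Weights m d |
        NearlyOrthogonal ε v μ ω.1 ∧ ¬ SmallInit ε μ ω.1 ω.2}
      ⊆ {ω | ∃ p : ℤˣ × Fin m × Fin n,
            ‖ω.1 p.2.2‖ ^ 2 ≤ 2 * v ∧ ε < |inner ℝ (ω.2 p.1 p.2.1) (ω.1 p.2.2)|}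
        ∪ {ω | ∃ p : ℤˣ × Fin m, ε < |inner ℝ (ω.2 p.1 p.2) μ|} := by
    rintro ω ⟨hortho, hω⟩
    by_contra hgood
    simp only [Set.mem_union, Set.mem_ofPred_eq, not_or, not_exists, not_and, not_lt,
      Prod.forall] at hgood
    obtain ⟨hnoise, hsignal⟩ := hgood
    exact hω ⟨fun j r i ↦ hnoise j r i (by nlinarith [(abs_le.1 (hortho.norm_sq i)).2]), hsignal⟩
  calc _ ≤ 2 * (m * n) * (2 * Real.exp (-a)) + 2 * m * (2 * Real.exp (-a)) :=
        (measureReal_mono hsubset).trans <| (measureReal_union_le _ _).trans <| add_le_add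
          (init_noise_failure_le hσ0 (mul_pos two_pos hv) hε₀ (hrescale (by linarith)))
          (init_signal_failure_le hσ0 (by positivity) hμ_sq hε₀
            (hrescale (by linarith)))
    _ = 2 * (m * n + m) * (2 * Real.exp (-a)) := by ring

lemma sq_mul_exp_neg_six_mul_log_le {N δ : ℝ} (hN : 2 ≤ N) (hδ₀ : 0 < δ) (hδ : δ ≤ 1) :
    N ^ 2 * Real.exp (-(6 * Real.log (N / δ))) ≤ δ / 16 := by
  have hexp : Real.exp (-(6 * Real.log (N / δ))) = (δ / N) ^ 6 := by
    rw [← mul_neg, ← Real.log_inv, inv_div, mul_comm, Real.exp_mul, Real.exp_log (by positivity)]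
    exact_mod_cast Real.rpow_natCast _ 6
  have hN₄ : 16 ≤ N ^ 4 := by
    calc (16 : ℝ) = 2 ^ 4 := by norm_num
      _ ≤ N ^ 4 := by gcongr
  have hδ₅ : δ ^ 5 ≤ 1 := pow_le_one₀ hδ₀.le hδ
  calc N ^ 2 * Real.exp (-(6 * Real.log (N / δ))) = δ ^ 5 * δ / N ^ 4 := by
        rw [hexp]
        field_simp
    _ ≤ 1 * δ / 16 := by gcongr
    _ = δ / 16 := by ring

variable {δ : ℝ}

lemma not_nearlyOrthogonal_and_smallInit_le (hn : 2 ≤ n) (hm : 0 < m) (hd : 0 < d)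
    (hσξ : σξ ≠ 0) (hσ0 : σ0 ≠ 0) (hε₀ : 0 ≤ ε) (hε : ε ≤ 1) (hκ : 1 ≤ κ) (hδ₀ : 0 < δ)
    (hδ : δ ≤ 1) (hμ : n * ‖μ‖ ^ 2 ≤ κ * (σξ ^ 2 * d))
    (hlog : 24 * κ * (n ^ 2 * Real.log (n * m / δ)) ≤ ε ^ 2 * d)
    (hinit : σ0 ^ 2 * (σξ ^ 2 * d) * d ≤ n) :
    (noiseInitLaw n m d σξ σ0).real
      {ω | ¬ (NearlyOrthogonal ε (σξ ^ 2 * d) μ ω.1 ∧ SmallInit ε μ ω.1 ω.2)} ≤ δ / 2 := by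
  have hn₂ : (2 : ℝ) ≤ n := by exact_mod_cast hn
  have hm₁ : (1 : ℝ) ≤ m := by exact_mod_cast hm
  have hN : (2 : ℝ) ≤ n * m := by nlinarith
  set a := 6 * Real.log (n * m / δ) with ha
  have ha₀ : 0 ≤ a := by
    have := Real.log_nonneg ((one_le_div hδ₀).2 (by linarith : δ ≤ n * m))
    linarith
  have hlog_sq : 4 * κ * n ^ 2 * a ≤ ε ^ 2 * d := by rw [ha]; linarith
  have hlog_mul : 4 * κ * n * a ≤ ε ^ 2 * d := by
    refine le_trans ?_ hlog_sq
    gcongr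
    nlinarith
  have hcount : (n ^ 2 + 2 * n + 2 * (m * n + m)) * 2 ≤ 8 * ((n : ℝ) * m) ^ 2 := by
    have hnN : (n : ℝ) ≤ n * m := le_mul_of_one_le_right (by linarith) hm₁
    have hmN : (m : ℝ) ≤ n * m := le_mul_of_one_le_left (by linarith) (by linarith)
    nlinarith [hnN, hmN]
  have hsubset : {ω : (Fin n → Patch d) × Weights m d |
        ¬ (NearlyOrthogonal ε (σξ ^ 2 * d) μ ω.1 ∧ SmallInit ε μ ω.1 ω.2)}
      ⊆ {ω | ¬ NearlyOrthogonal ε (σξ ^ 2 * d) μ ω.1}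
        ∪ {ω | NearlyOrthogonal ε (σξ ^ 2 * d) μ ω.1 ∧ ¬ SmallInit ε μ ω.1 ω.2} := fun ω hω ↦ by
    simp only [Set.mem_union, Set.mem_ofPred_eq] at hω ⊢
    tauto
  calc _ ≤ (n ^ 2 + 2 * n) * (2 * Real.exp (-a)) + 2 * (m * n + m) * (2 * Real.exp (-a)) :=
        (measureReal_mono hsubset).trans <| (measureReal_union_le _ _).trans <| add_le_add
          (not_nearlyOrthogonal_le hn hd hσξ hε₀ hε hκ ha₀ hμ hlog_sq)
          (nearlyOrthogonal_and_not_smallInit_le (by omega) hd hσξ hσ0 hε₀ hε hκ ha₀ hμ hlog_mul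
            hinit)
    _ = (n ^ 2 + 2 * n + 2 * (m * n + m)) * 2 * Real.exp (-a) := by ring
    _ ≤ 8 * (n * m) ^ 2 * Real.exp (-a) := mul_le_mul_of_nonneg_right hcount (Real.exp_pos _).le
    _ ≤ δ / 2 := by linarith [sq_mul_exp_neg_six_mul_log_le hN hδ₀ hδ]

end GoodEvents

/-! ### Label counts -/

section Labels

variable {n : ℕ} {τp τm τ lo hi b θ : ℝ}

lemma flipProb_mem (hp : τp ∈ Set.Icc lo hi) (hm : τm ∈ Set.Icc lo hi) (a : ℤˣ) :
    flipProb τp τm a ∈ Set.Icc lo hi := by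
  unfold flipProb
  split_ifs <;> assumption

lemma flipProb_le (hp : τp ≤ τ) (hm : τm ≤ τ) (a : ℤˣ) : flipProb τp τm a ≤ τ := by
  unfold flipProb
  split_ifs <;> assumption

lemma sgn_mul_sgn (a b : ℤˣ) : sgn a * sgn b = if b = a then 1 else -1 := by
  rcases Int.units_eq_one_or a with rfl | rfl <;>
    rcases Int.units_eq_one_or b with rfl | rfl <;> simp [sgn]

lemma BalancedLabels.labelMargin {y yObs : Fin n → ℤˣ} (h : BalancedLabels τp τm y yObs)
    (hb : ∀ a, b ≤ (1 - 2 * flipProb τp τm a) / 2) : LabelMargin b y yObs := fun a ↦ by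
  have hcount : ∑ i with y i = a, sgn (y i) * sgn (yObs i)
      = ((Finset.univ.filter fun i ↦ y i = a ∧ yObs i = y i).card : ℝ)
        - (Finset.univ.filter fun i ↦ y i = a ∧ yObs i ≠ y i).card := by
    simp only [sgn_mul_sgn, Finset.sum_ite, Finset.filter_filter, Finset.sum_const, nsmul_eq_mul,
      mul_one, mul_neg, sub_eq_add_neg]
  rw [hcount, (h a).1, (h a).2]
  linarith [mul_le_mul_of_nonneg_right (hb a) (Nat.cast_nonneg (α := ℝ) n)]

instance measurableSingletonClass_intUnits : MeasurableSingletonClass ℤˣ where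
  measurableSet_singleton a :=
    ⟨{(a : ℤ)}, measurableSet_singleton _, by ext b; simp [Units.ext_iff]⟩

lemma sum_intUnits {M : Type*} [AddCommMonoid M] (f : ℤˣ → M) (a : ℤˣ) :
    ∑ c, f c = f a + f (-a) := by
  have huniv : (Finset.univ : Finset ℤˣ) = {a, -a} := by
    rcases Int.units_eq_one_or a with rfl | rfl <;> decide
  rw [huniv, Finset.sum_pair (units_ne_neg_self a)]

lemma lintegral_labelLaw (τp τm : ℝ) (f : ℤˣ × ℤˣ → ENNReal) :
    ∫⁻ p, f p ∂labelLaw τp τm = ∑ y, (ENNReal.ofReal (1 / 2 * (1 - flipProb τp τm y)) * f (y, y)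
      + ENNReal.ofReal (1 / 2 * flipProb τp τm y) * f (y, -y)) := by
  simp only [labelLaw, lintegral_finsetSum_measure, lintegral_smul_measure, lintegral_dirac,
    smul_eq_mul]
  refine Finset.sum_congr rfl fun y _ ↦ ?_
  rw [sum_intUnits _ y, if_pos rfl, if_neg (neg_units_ne_self y)]

lemma isProbabilityMeasure_labelLaw (hp : τp ∈ Set.Icc 0 1) (hm : τm ∈ Set.Icc 0 1) :
    IsProbabilityMeasure (labelLaw τp τm) where
  measure_univ := by
    have hflip (y : ℤˣ) : ENNReal.ofReal (1 / 2 * (1 - flipProb τp τm y))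
        + ENNReal.ofReal (1 / 2 * flipProb τp τm y) = ENNReal.ofReal (1 / 2) := by
      have h := flipProb_mem hp hm y
      rw [← ENNReal.ofReal_add (by linarith [h.2]) (by linarith [h.1])]
      ring_nf
    rw [← lintegral_one, lintegral_labelLaw]
    simp only [mul_one, hflip]
    rw [sum_intUnits _ 1, ← ENNReal.ofReal_add (by norm_num) (by norm_num)]
    norm_num

lemma integral_labelLaw (hp : τp ∈ Set.Icc 0 1) (hm : τm ∈ Set.Icc 0 1) (f : ℤˣ × ℤˣ → ℝ) :
    ∫ p, f p ∂labelLaw τp τm = 1 / 2 * ∑ y, ((1 - flipProb τp τm y) * f (y, y)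
      + flipProb τp τm y * f (y, -y)) := by
  have hdirac (c : ℝ) (q : ℤˣ × ℤˣ) : Integrable f (ENNReal.ofReal c • Measure.dirac q) :=
    (integrable_dirac (by simp)).smul_measure ENNReal.ofReal_ne_top
  rw [labelLaw, integral_finsetSum_measure fun y _ ↦
    integrable_finsetSum_measure.2 fun y' _ ↦ hdirac _ _, Finset.mul_sum]
  refine Finset.sum_congr rfl fun y _ ↦ ?_
  have h := flipProb_mem hp hm y
  rw [integral_finsetSum_measure fun y' _ ↦ hdirac _ _, sum_intUnits _ y, if_pos rfl,
    if_neg (neg_units_ne_self y)]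
  simp only [integral_smul_measure, integral_dirac, smul_eq_mul]
  rw [ENNReal.toReal_ofReal (by linarith [h.2]), ENNReal.toReal_ofReal (by linarith [h.1])]
  ring

/-- The contribution of the labelled sample `p = (y, ỹ)` to the sum in `LabelMargin` for the
class `a`. -/
noncomputable def classMargin (a : ℤˣ) (p : ℤˣ × ℤˣ) : ℝ :=
  if p.1 = a then sgn p.1 * sgn p.2 else 0

lemma classMargin_mem (a : ℤˣ) (p : ℤˣ × ℤˣ) : classMargin a p ∈ Set.Icc (-1) 1 := by
  rw [Set.mem_Icc, ← abs_le, classMargin]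
  split_ifs
  · rw [abs_mul, abs_sgn, abs_sgn, one_mul]
  · simp

lemma integral_classMargin (hp : τp ∈ Set.Icc 0 1) (hm : τm ∈ Set.Icc 0 1) (a : ℤˣ) :
    ∫ p, classMargin a p ∂labelLaw τp τm = (1 - 2 * flipProb τp τm a) / 2 := by
  rw [integral_labelLaw hp hm, sum_intUnits _ a]
  simp only [classMargin, ↓reduceIte, if_neg (neg_units_ne_self a), sgn_mul_sgn]
  ring

lemma pi_real_sum_lt_le {Ω ι : Type*} [MeasurableSpace Ω] [Fintype ι] {P : Measure Ω}
    [IsProbabilityMeasure P] {X : Ω → ℝ} (hX : AEMeasurable X P)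
    (hmem : ∀ᵐ ω ∂P, X ω ∈ Set.Icc (-1) 1) (hθ : 0 ≤ θ) :
    (Measure.pi fun _ : ι ↦ P).real {ω | ∑ i, X (ω i) < (P[X] - θ) * Fintype.card ι}
      ≤ Real.exp (-(θ ^ 2 * Fintype.card ι / 2)) := by
  set N : ℝ := (Fintype.card ι : ℝ)
  set Y : Ω → ℝ := fun ω ↦ -(X ω - P[X]) with hY
  have hparam : (‖(1 : ℝ) - (-1)‖₊ / 2) ^ 2 = 1 := by
    ext
    push_cast
    norm_num
  have hsubgauss : HasSubgaussianMGF Y 1 P :=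
    hparam ▸ (hasSubgaussianMGF_of_mem_Icc hX hmem).neg
  have heval (i : ι) : HasSubgaussianMGF (fun ω : ι → Ω ↦ Y (ω i)) 1 (Measure.pi fun _ ↦ P) :=
    HasSubgaussianMGF.of_map (μ := Measure.pi fun _ ↦ P) (Y := Function.eval i) (X := Y)
      (measurable_pi_apply i).aemeasurable
      (by rwa [(measurePreserving_eval (fun _ : ι ↦ P) i).map_eq])
  have hsum := HasSubgaussianMGF.measure_sum_ge_le_of_iIndepFun (s := Finset.univ)
    (iIndepFun_pi (μ := fun _ : ι ↦ P) (X := fun _ ↦ Y) fun _ ↦ hsubgauss.aemeasurable)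
    (fun i _ ↦ heval i) (ε := θ * N) (by positivity)
  refine (measureReal_mono fun ω hω ↦ ?_).trans (hsum.trans_eq ?_)
  · have hsum_eq : ∑ i, Y (ω i) = N * P[X] - ∑ i, X (ω i) := by
      simp [hY, N]
    simp only [Set.mem_ofPred_eq] at hω ⊢
    rw [hsum_eq]
    linarith
  · have hvar : ((∑ _i : ι, 1 : NNReal) : ℝ) = N := by simp [N]
    rw [hvar]
    rcases eq_or_ne N 0 with hN | hN
    · simp [hN]
    · congr 1
      field_simp

lemma not_labelMargin_le (hp : τp ∈ Set.Icc 0 1) (hm : τm ∈ Set.Icc 0 1) (hθ : 0 ≤ θ)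
    (hb : ∀ a, b + θ ≤ (1 - 2 * flipProb τp τm a) / 2) :
    (Measure.pi fun _ : Fin n ↦ labelLaw τp τm).real
        {ω | ¬ LabelMargin b (fun i ↦ (ω i).1) (fun i ↦ (ω i).2)}
      ≤ 2 * Real.exp (-(θ ^ 2 * n / 2)) := by
  have := isProbabilityMeasure_labelLaw hp hm
  have hclass (a : ℤˣ) : (Measure.pi fun _ : Fin n ↦ labelLaw τp τm).real
      {ω | ∑ i, classMargin a (ω i) < b * n} ≤ Real.exp (-(θ ^ 2 * n / 2)) := by
    have h := pi_real_sum_lt_le (ι := Fin n) (X := classMargin a)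
      (measurable_of_countable _).aemeasurable
      (ae_of_all (labelLaw τp τm) (classMargin_mem a)) hθ
    rw [integral_classMargin hp hm, Fintype.card_fin] at h
    refine le_trans (measureReal_mono (Set.ofPred_subset_ofPred.2 fun ω hω ↦ hω.trans_le ?_)) h
    gcongr
    linarith [hb a]
  have hexists := measureReal_exists_le hclass
  rw [show Fintype.card ℤˣ = 2 from rfl] at hexists
  refine le_trans (measureReal_mono fun ω hω ↦ ?_) hexists
  simpa only [Set.mem_ofPred_eq, LabelMargin, not_forall, not_le, classMargin,
    ← Finset.sum_filter] using hω

lemma not_labelMargin_le_of_log_le {δ : ℝ} (hp : τp ∈ Set.Icc 0 1) (hm : τm ∈ Set.Icc 0 1)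
    (hθ : 0 ≤ θ) (hδ : 0 < δ) (hb : ∀ a, b + θ ≤ (1 - 2 * flipProb τp τm a) / 2)
    (hn : 4 * Real.log (2 / δ) ≤ θ ^ 2 * n) (hδ₁ : δ ≤ 1) :
    (Measure.pi fun _ : Fin n ↦ labelLaw τp τm).real
        {ω | ¬ LabelMargin b (fun i ↦ (ω i).1) (fun i ↦ (ω i).2)} ≤ δ / 2 := by
  refine (not_labelMargin_le hp hm hθ hb).trans ?_
  calc 2 * Real.exp (-(θ ^ 2 * n / 2)) ≤ 2 * Real.exp (-(2 * Real.log (2 / δ))) := by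
        gcongr
        linarith
    _ = 2 * (δ / 2) ^ 2 := by
        rw [two_mul (Real.log _), neg_add, Real.exp_add, ← Real.log_inv, inv_div,
          Real.exp_log (by positivity), sq]
    _ ≤ δ / 2 := by nlinarith

end Labels

/-! ### Constants and parameter regime -/

/-- The conditions under which the first stage of training runs its course: bounds on the sizes `n`,
`m` and `d`, on the initial weights and on the step size. -/
structure StageOneRegime (C κlo κhi : ℝ) (n m d : ℕ) (μ : Patch d) (σξ σ0 η δ : ℝ) : Prop where
  two_le_n : 2 ≤ n
  m_pos : 0 < m
  δ_pos : 0 < δ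
  δ_le_one : δ ≤ 1
  σξ_pos : 0 < σξ
  σ0_pos : 0 < σ0
  η_pos : 0 < η
  snr_mem : n * snr μ σξ ^ 2 ∈ Set.Icc κlo κhi
  d_large : C * ((n : ℝ) ^ 2 * Real.log (n * m / δ)) ≤ d
  σ0_small : σ0 ≤ C⁻¹ * (√(n : ℝ) * σξ⁻¹ * (d : ℝ)⁻¹)
  η_small : η ≤ C⁻¹ * ((σξ ^ 2)⁻¹ * (d : ℝ)⁻¹ * n * m)

/-- The numerical constants of the first stage: `θ` bounds the activations and the loss of label
margin, `s` is the length of the stage as measured by `gdTime`, and `ε` is the tolerance in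
`NearlyOrthogonal` and `SmallInit`. -/
structure StageOneConstants (κlo κhi τhi θ s ε C : ℝ) : Prop where
  two_lt_κlo : 2 < κlo
  κlo_le_κhi : κlo ≤ κhi
  θ_pos : 0 < θ
  θ_le : θ ≤ 1 / 8
  gap : 1 / 2 + 3 * θ ≤ κlo * (((1 - 2 * τhi) / 2 - θ) / 2 - θ)
  s_pos : 0 < s
  s_mul : 4 * s * (κhi + 2) = θ
  ε_eq : 8 * ε = s * θ
  C_mul : C * ε ^ 2 = 24 * κhi

lemma exists_stageOneConstants {κlo κhi τhi : ℝ} (hκ : κlo ≤ κhi) (hτ : 0 ≤ τhi)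
    (hτhi : τhi < 1 / 2) (hκτ : 2 < κlo * (1 - 2 * τhi)) :
    ∃ θ s ε C, StageOneConstants κlo κhi τhi θ s ε C := by
  have hκlo : 2 < κlo := by nlinarith
  have hκhi : 2 < κhi := hκlo.trans_le hκ
  set θ := min (1 / 8) ((κlo * (1 - 2 * τhi) - 2) / (12 + 6 * κlo))
  have hθ : 0 < θ := lt_min (by norm_num) (div_pos (by linarith) (by linarith))
  have hθ_le : θ ≤ (κlo * (1 - 2 * τhi) - 2) / (12 + 6 * κlo) := min_le_right _ _
  rw [le_div_iff₀ (by linarith)] at hθ_le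
  set s := θ / (4 * (κhi + 2))
  have hs : 0 < s := by positivity
  exact ⟨θ, s, s * θ / 8, 24 * κhi / (s * θ / 8) ^ 2,
    { two_lt_κlo := hκlo
      κlo_le_κhi := hκ
      θ_pos := hθ
      θ_le := min_le_left _ _
      gap := by linarith
      s_pos := hs
      s_mul := by simp only [s]; field_simp
      ε_eq := by ring
      C_mul := by field_simp }⟩

namespace StageOneConstants

variable {κlo κhi τhi θ s ε C : ℝ}

lemma ε_pos (K : StageOneConstants κlo κhi τhi θ s ε C) : 0 < ε := by
  linarith [K.ε_eq, mul_pos K.s_pos K.θ_pos]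

lemma s_le (K : StageOneConstants κlo κhi τhi θ s ε C) : s ≤ 1 / 8 := by
  nlinarith [K.s_mul, K.s_pos, K.θ_le, K.two_lt_κlo, K.κlo_le_κhi]

lemma ε_le_s (K : StageOneConstants κlo κhi τhi θ s ε C) : ε ≤ s := by
  nlinarith [K.ε_eq, K.s_pos, K.θ_le]

lemma ε_le_θ (K : StageOneConstants κlo κhi τhi θ s ε C) : ε ≤ θ := by
  nlinarith [K.ε_eq, K.θ_pos, K.s_le]

lemma C_pos (K : StageOneConstants κlo κhi τhi θ s ε C) : 0 < C :=
  pos_of_mul_pos_left (K.C_mul ▸ by linarith [K.two_lt_κlo, K.κlo_le_κhi]) (sq_nonneg ε)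

lemma le_C_mul (K : StageOneConstants κlo κhi τhi θ s ε C) {a : ℝ} (ha : ε ^ 2 ≤ a) :
    48 ≤ C * a := by
  have h := mul_le_mul_of_nonneg_left ha K.C_pos.le
  linarith [K.C_mul, K.two_lt_κlo, K.κlo_le_κhi]

lemma two_le_C (K : StageOneConstants κlo κhi τhi θ s ε C) : 2 ≤ C := by
  have h := K.le_C_mul (pow_le_one₀ K.ε_pos.le (by linarith [K.ε_le_θ, K.θ_le]))
  linarith

lemma one_le_s_mul_C (K : StageOneConstants κlo κhi τhi θ s ε C) : 1 ≤ s * C := by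
  have h := K.le_C_mul (a := s) (by nlinarith [K.ε_pos, K.ε_le_s, K.s_le])
  linarith

lemma four_le_C_mul_θ_sq (K : StageOneConstants κlo κhi τhi θ s ε C) : 4 ≤ C * θ ^ 2 := by
  have h := K.le_C_mul (pow_le_pow_left₀ K.ε_pos.le K.ε_le_θ 2)
  linarith

lemma crosstalk (K : StageOneConstants κlo κhi τhi θ s ε C) : 12 * (ε * (κhi + 2)) ≤ 1 := by
  have h : 32 * (ε * (κhi + 2)) = θ ^ 2 := by
    linear_combination 4 * (κhi + 2) * K.ε_eq + θ * K.s_mul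
  nlinarith [K.θ_pos, K.θ_le]

end StageOneConstants

lemma snr_sq {d : ℕ} (μ : Patch d) (σξ : ℝ) : snr μ σξ ^ 2 = ‖μ‖ ^ 2 / (σξ ^ 2 * d) := by
  rw [snr, div_pow, mul_pow, Real.sq_sqrt (Nat.cast_nonneg _)]

namespace Regime

variable {C κlo κhi τlo τhi : ℝ} {n m d : ℕ} {μ : Patch d} {σξ σ0 η δ τp τm : ℝ}

lemma two_le_m (R : Regime C κlo κhi τlo τhi n m d μ σξ σ0 η δ τp τm) (hC : 2 ≤ C) : 2 ≤ m := by
  have hnδ : (2 : ℝ) ≤ n / δ := by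
    have hn : (2 : ℝ) ≤ n := mod_cast R.two_le_n
    rw [le_div_iff₀ R.δ_pos]
    linarith [R.δ_lt_one]
  have hlog : 1 / 2 < Real.log (n / δ) :=
    lt_of_lt_of_le (by linarith [Real.log_two_gt_d9]) (Real.log_le_log two_pos hnδ)
  have hm : (1 : ℝ) < m := by nlinarith [R.m_large]
  exact_mod_cast hm

lemma stageOneRegime (R : Regime C κlo κhi τlo τhi n m d μ σξ σ0 η δ τp τm) (hC : 2 ≤ C) :
    StageOneRegime C κlo κhi n m d μ σξ σ0 η δ where
  two_le_n := R.two_le_n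
  m_pos := by linarith [R.two_le_m hC]
  δ_pos := R.δ_pos
  δ_le_one := R.δ_lt_one.le
  σξ_pos := R.σξ_pos
  σ0_pos := R.σ0_pos
  η_pos := R.η_pos
  snr_mem := ⟨R.snr_lower, R.snr_upper⟩
  d_large := le_trans (by gcongr; exact le_max_left _ _) R.d_large
  σ0_small := R.σ0_small.trans (by gcongr; exact min_le_left _ _)
  η_small := by
    have hm : (1 : ℝ) ≤ m := mod_cast one_le_two.trans (R.two_le_m hC)
    refine R.η_small.trans ?_
    gcongr
    exact (min_le_right _ _).trans (le_mul_of_one_le_right (by positivity) hm)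

lemma mul_log_le (R : Regime C κlo κhi τlo τhi n m d μ σξ σ0 η δ τp τm) (hC : 2 ≤ C) :
    C * Real.log (2 / δ) ≤ n := by
  have hδ := R.δ_pos
  have hm : (2 : ℝ) ≤ m := mod_cast R.two_le_m hC
  refine le_trans ?_ R.n_large
  gcongr

end Regime

namespace StageOneRegime

variable {C κlo κhi τhi θ s ε : ℝ} {n m d : ℕ} {μ : Patch d} {σξ σ0 η δ : ℝ}

lemma d_pos (R : StageOneRegime C κlo κhi n m d μ σξ σ0 η δ) (hκ : 0 < κlo) : 0 < d := by
  refine Nat.pos_of_ne_zero fun hd ↦ hκ.not_ge (R.snr_mem.1.trans ?_)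
  simp [snr_sq, hd]

lemma variance_pos (R : StageOneRegime C κlo κhi n m d μ σξ σ0 η δ) (hκ : 0 < κlo) :
    0 < σξ ^ 2 * d :=
  mul_pos (pow_pos R.σξ_pos 2) (Nat.cast_pos.2 (R.d_pos hκ))

lemma le_signal (R : StageOneRegime C κlo κhi n m d μ σξ σ0 η δ) (hκ : 0 < κlo) :
    κlo * (σξ ^ 2 * d) ≤ n * ‖μ‖ ^ 2 := by
  rw [← le_div_iff₀ (R.variance_pos hκ), mul_div_assoc, ← snr_sq]
  exact R.snr_mem.1

lemma signal_le (R : StageOneRegime C κlo κhi n m d μ σξ σ0 η δ) (hκ : 0 < κlo) :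
    n * ‖μ‖ ^ 2 ≤ κhi * (σξ ^ 2 * d) := by
  rw [← div_le_iff₀ (R.variance_pos hκ), mul_div_assoc, ← snr_sq]
  exact R.snr_mem.2

lemma init_variance_le (R : StageOneRegime C κlo κhi n m d μ σξ σ0 η δ) (hκ : 0 < κlo)
    (hC : 1 ≤ C) : σ0 ^ 2 * (σξ ^ 2 * d) * d ≤ n := by
  have hd : (0 : ℝ) < d := Nat.cast_pos.2 (R.d_pos hκ)
  have hσξ := R.σξ_pos
  have hσ0 := R.σ0_pos
  have hle : σ0 * σξ * d ≤ √n := by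
    have h := R.σ0_small.trans (mul_le_of_le_one_left (by positivity) (inv_le_one_of_one_le₀ hC))
    calc σ0 * σξ * d ≤ √n * σξ⁻¹ * (d : ℝ)⁻¹ * σξ * d := by gcongr
      _ = √n := by field_simp
  calc σ0 ^ 2 * (σξ ^ 2 * d) * d = (σ0 * σξ * d) ^ 2 := by ring
    _ ≤ √n ^ 2 := by gcongr
    _ = n := Real.sq_sqrt (Nat.cast_nonneg n)

lemma not_nearlyOrthogonal_and_smallInit_le
    (R : StageOneRegime C κlo κhi n m d μ σξ σ0 η δ)
    (K : StageOneConstants κlo κhi τhi θ s ε C) :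
    (noiseInitLaw n m d σξ σ0).real
        {ω | ¬ (NearlyOrthogonal ε (σξ ^ 2 * d) μ ω.1 ∧ SmallInit ε μ ω.1 ω.2)} ≤ δ / 2 := by
  have hκ : 0 < κlo := two_pos.trans K.two_lt_κlo
  refine LabelNoiseCNN.not_nearlyOrthogonal_and_smallInit_le (κ := κhi) R.two_le_n R.m_pos
    (R.d_pos hκ) R.σξ_pos.ne' R.σ0_pos.ne' K.ε_pos.le (by linarith [K.ε_le_θ, K.θ_le])
    (by linarith [K.two_lt_κlo, K.κlo_le_κhi]) R.δ_pos R.δ_le_one (R.signal_le hκ) ?_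
    (R.init_variance_le hκ (by linarith [K.two_le_C]))
  rw [← K.C_mul]
  linarith [mul_le_mul_of_nonneg_left R.d_large (sq_nonneg ε)]

lemma exists_time (R : StageOneRegime C κlo κhi n m d μ σξ σ0 η δ) (hκ : 0 < κlo) (hC : 0 < C)
    (hs : 0 < s) (hsC : 1 ≤ s * C) :
    ∃ T : ℕ, (T : ℝ) ∈ Set.Icc (s * (η⁻¹ * n * m * (σξ ^ 2)⁻¹ * (d : ℝ)⁻¹))
        (2 * s * (η⁻¹ * n * m * (σξ ^ 2)⁻¹ * (d : ℝ)⁻¹)) ∧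
      gdTime n m η (σξ ^ 2 * d) T ∈ Set.Icc s (2 * s) := by
  have hd : (0 : ℝ) < d := Nat.cast_pos.2 (R.d_pos hκ)
  have hn : (0 : ℝ) < n := Nat.cast_pos.2 (two_pos.trans_le R.two_le_n)
  have hm : (0 : ℝ) < m := Nat.cast_pos.2 R.m_pos
  have hσξ := R.σξ_pos
  have hη := R.η_pos
  set U := η⁻¹ * n * m * (σξ ^ 2)⁻¹ * (d : ℝ)⁻¹ with hU
  have hCU : C ≤ U := by
    have h := R.η_small
    rw [← div_eq_inv_mul, le_div_iff₀ hC, mul_comm, ← le_div_iff₀ hη] at h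
    exact h.trans_eq (by rw [hU]; field_simp)
  have hsU : 1 ≤ s * U := hsC.trans (by gcongr)
  have hstep : s * U * (η / (n * m) * (σξ ^ 2 * d)) = s := by rw [hU]; field_simp
  have hlower : s * U ≤ ⌈s * U⌉₊ := Nat.le_ceil _
  have hupper : (⌈s * U⌉₊ : ℝ) ≤ 2 * s * U := by
    linarith [Nat.ceil_lt_add_one (zero_le_one.trans hsU)]
  refine ⟨⌈s * U⌉₊, ⟨hlower, hupper⟩, ?_, ?_⟩
  · calc s = s * U * (η / (n * m) * (σξ ^ 2 * d)) := hstep.symm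
      _ ≤ ⌈s * U⌉₊ * (η / (n * m) * (σξ ^ 2 * d)) := by gcongr
  · calc ⌈s * U⌉₊ * (η / (n * m) * (σξ ^ 2 * d))
        ≤ 2 * s * U * (η / (n * m) * (σξ ^ 2 * d)) := by gcongr
      _ = 2 * s := by linear_combination 2 * hstep

lemma stageOneOutcome (R : StageOneRegime C κlo κhi n m d μ σξ σ0 η δ)
    (K : StageOneConstants κlo κhi τhi θ s ε C) {T : ℕ}
    (hT : gdTime n m η (σξ ^ 2 * d) T ∈ Set.Icc s (2 * s))
    {y yObs : Fin n → ℤˣ} {ξ : Fin n → Patch d} {W₀ : Weights m d}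
    (hlabel : LabelMargin ((1 - 2 * τhi) / 2 - θ) y yObs)
    (hgood : NearlyOrthogonal ε (σξ ^ 2 * d) μ ξ ∧ SmallInit ε μ ξ W₀) :
    StageOneOutcome (s / 4) 1 ⟨μ, y, yObs, ξ⟩ η W₀ T := by
  have hκ : 0 < κlo := two_pos.trans K.two_lt_κlo
  have hκhi : 0 < κhi + 2 := by linarith [K.κlo_le_κhi]
  have hsθ : s * θ ≤ θ := mul_le_of_le_one_left K.θ_pos.le (by linarith [K.s_le])
  have H : FirstStage ε (σξ ^ 2 * d) κlo κhi θ ⟨μ, y, yObs, ξ⟩ η W₀ T :=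
    { m_pos := R.m_pos
      η_nonneg := R.η_pos.le
      ε_pos := K.ε_pos
      v_pos := R.variance_pos hκ
      θ_le := K.θ_le
      one_le_κlo := by linarith [K.two_lt_κlo]
      le_signal := R.le_signal hκ
      signal_le := R.signal_le hκ
      ortho := hgood.1
      init := hgood.2
      crosstalk := K.crosstalk
      small := by
        linarith [mul_le_mul_of_nonneg_right hT.2 hκhi.le, K.s_mul, K.ε_eq] }
  have hmargin : 0 < ((1 - 2 * τhi) / 2 - θ) / 2 - θ :=
    pos_of_mul_pos_right (lt_of_lt_of_le (by linarith [K.θ_pos]) K.gap) hκ.le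
  refine H.stageOneOutcome (by linarith) hlabel K.gap ?_ (by linarith [hT.1])
  linarith [mul_le_mul_of_nonneg_right hT.1 K.θ_pos.le, K.ε_eq, K.ε_pos]

lemma balanced_failure_le (R : StageOneRegime C κlo κhi n m d μ σξ σ0 η δ)
    (K : StageOneConstants κlo κhi τhi θ s ε C) {T : ℕ}
    (hT : gdTime n m η (σξ ^ 2 * d) T ∈ Set.Icc s (2 * s)) {τp τm : ℝ} (hp : τp ≤ τhi)
    (hm : τm ≤ τhi) {y yObs : Fin n → ℤˣ} (hbal : BalancedLabels τp τm y yObs) :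
    (noiseInitLaw n m d σξ σ0).real
        {ω | ¬ StageOneOutcome (s / 4) 1 ⟨μ, y, yObs, ω.1⟩ η ω.2 T} ≤ δ := by
  have hlabel : LabelMargin ((1 - 2 * τhi) / 2 - θ) y yObs :=
    hbal.labelMargin fun a ↦ by linarith [flipProb_le hp hm a, K.θ_pos]
  refine (measureReal_mono (Set.ofPred_subset_ofPred.2 fun ω hω hgood ↦
    hω (R.stageOneOutcome K hT hlabel hgood))).trans
      ((R.not_nearlyOrthogonal_and_smallInit_le K).trans ?_)
  linarith [R.δ_pos]

lemma random_failure_le (R : StageOneRegime C κlo κhi n m d μ σξ σ0 η δ)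
    (K : StageOneConstants κlo κhi τhi θ s ε C) {T : ℕ}
    (hT : gdTime n m η (σξ ^ 2 * d) T ∈ Set.Icc s (2 * s)) (hn : C * Real.log (2 / δ) ≤ n)
    (hτhi : τhi ≤ 1) {τp τm : ℝ} (hp : τp ∈ Set.Icc 0 τhi) (hm : τm ∈ Set.Icc 0 τhi) :
    ((Measure.pi fun _ : Fin n ↦ labelLaw τp τm).prod (noiseInitLaw n m d σξ σ0)).real
        {ω | ¬ StageOneOutcome (s / 4) 1 ⟨μ, fun i ↦ (ω.1 i).1, fun i ↦ (ω.1 i).2, ω.2.1⟩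
          η ω.2.2 T} ≤ δ := by
  have hunit : Set.Icc 0 τhi ⊆ Set.Icc 0 1 := Set.Icc_subset_Icc_right hτhi
  have := isProbabilityMeasure_labelLaw (hunit hp) (hunit hm)
  have hlog : 4 * Real.log (2 / δ) ≤ θ ^ 2 * n := by
    have hlog_nonneg : 0 ≤ Real.log (2 / δ) := by
      refine Real.log_nonneg ((one_le_div R.δ_pos).2 ?_)
      linarith [R.δ_le_one]
    linarith [mul_le_mul_of_nonneg_left hn (sq_nonneg θ),
      mul_le_mul_of_nonneg_right K.four_le_C_mul_θ_sq hlog_nonneg]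
  have hlabel := not_labelMargin_le_of_log_le (b := (1 - 2 * τhi) / 2 - θ) (hunit hp) (hunit hm)
    K.θ_pos.le R.δ_pos (fun a ↦ by linarith [flipProb_le hp.2 hm.2 a]) hlog R.δ_le_one
  set A := {ω : Fin n → ℤˣ × ℤˣ |
    ¬ LabelMargin ((1 - 2 * τhi) / 2 - θ) (fun i ↦ (ω i).1) (fun i ↦ (ω i).2)}
  set B := {ω : (Fin n → Patch d) × Weights m d |
    ¬ (NearlyOrthogonal ε (σξ ^ 2 * d) μ ω.1 ∧ SmallInit ε μ ω.1 ω.2)}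
  have hsubset : {ω : (Fin n → ℤˣ × ℤˣ) × (Fin n → Patch d) × Weights m d |
      ¬ StageOneOutcome (s / 4) 1 ⟨μ, fun i ↦ (ω.1 i).1, fun i ↦ (ω.1 i).2, ω.2.1⟩ η ω.2.2 T}
      ⊆ A ×ˢ Set.univ ∪ Set.univ ×ˢ B := fun ω hω ↦ by
    by_contra hmem
    simp only [Set.mem_union, Set.mem_prod, Set.mem_univ, and_true, true_and, not_or] at hmem
    exact hω (R.stageOneOutcome K hT (not_not.1 hmem.1) (not_not.1 hmem.2))
  refine (measureReal_mono hsubset).trans ((measureReal_union_le _ _).trans ?_)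
  rw [measureReal_prod_prod, measureReal_prod_prod, probReal_univ, probReal_univ, mul_one, one_mul]
  linarith [R.not_nearlyOrthogonal_and_smallInit_le K]

end StageOneRegime

end LabelNoiseCNN

open LabelNoiseCNN MeasureTheory

theorem theorem4p1_general (κlo κhi τhi : ℝ) (hκ : κlo ≤ κhi) (hτ : 0 ≤ τhi) (hτhi : τhi < 1 / 2)
    (hκτ : 2 < κlo * (1 - 2 * τhi)) :
    ∃ C lo hi : ℝ, 2 ≤ C ∧ 0 < lo ∧ 0 < hi ∧
      ∀ (n m d : ℕ) (μ : Patch d) (σξ σ0 η δ : ℝ),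
        StageOneRegime C κlo κhi n m d μ σξ σ0 η δ →
        ∃ T₁ : ℕ,
          lo * (η⁻¹ * n * m * (σξ ^ 2)⁻¹ * (d : ℝ)⁻¹) ≤ T₁ ∧
          (T₁ : ℝ) ≤ hi * (η⁻¹ * n * m * (σξ ^ 2)⁻¹ * (d : ℝ)⁻¹) ∧
          (∀ τp τm : ℝ, τp ≤ τhi → τm ≤ τhi →
            ∀ y yObs : Fin n → ℤˣ, BalancedLabels τp τm y yObs →
              noiseInitLaw n m d σξ σ0
                {ω | ¬ StageOneOutcome lo hi ⟨μ, y, yObs, ω.1⟩ η ω.2 T₁} ≤ ENNReal.ofReal δ) ∧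
          (C * Real.log (2 / δ) ≤ n → ∀ τp ∈ Set.Icc 0 τhi, ∀ τm ∈ Set.Icc 0 τhi,
            (Measure.pi fun _ : Fin n ↦ labelLaw τp τm).prod (noiseInitLaw n m d σξ σ0)
              {ω | ¬ StageOneOutcome lo hi
                ⟨μ, fun i ↦ (ω.1 i).1, fun i ↦ (ω.1 i).2, ω.2.1⟩ η ω.2.2 T₁}
              ≤ ENNReal.ofReal δ) := by
  obtain ⟨θ, s, ε, C, K⟩ := exists_stageOneConstants hκ hτ hτhi hκτ
  have hs := K.s_pos
  refine ⟨C, s / 4, 1, K.two_le_C, by positivity, one_pos, fun n m d μ σξ σ0 η δ R ↦ ?_⟩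
  have hη := R.η_pos
  obtain ⟨T, ⟨hlower, hupper⟩, hT⟩ :=
    R.exists_time (two_pos.trans K.two_lt_κlo) K.C_pos hs K.one_le_s_mul_C
  refine ⟨T, le_trans (by gcongr; linarith) hlower, hupper.trans (by gcongr; linarith [K.s_le]),
    fun τp τm hp hm y yObs hbal ↦ ?_, fun hn τp hp τm hm ↦ ?_⟩
  · rw [← ofReal_measureReal]
    exact ENNReal.ofReal_le_ofReal (R.balanced_failure_le K hT hp hm hbal)
  · have := isProbabilityMeasure_labelLaw (τp := τp) (τm := τm)
      ⟨hp.1, by linarith [hp.2]⟩ ⟨hm.1, by linarith [hm.2]⟩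
    rw [← ofReal_measureReal]
    exact ENNReal.ofReal_le_ofReal (R.random_failure_le K hT hn (by linarith) hp hm)

theorem theorem4p1 (κlo κhi τlo τhi : ℝ) (hκ : κlo ≤ κhi) (hτlo : 0 < τlo) (hτ : τlo ≤ τhi)
    (hτhi : τhi < 1 / 2) (hκτ : 2 < κlo * (1 - 2 * τhi)) :
    ∃ C lo hi : ℝ, 0 < C ∧ 0 < lo ∧ 0 < hi ∧
      ∀ (n m d : ℕ) (μ : LabelNoiseCNN.Patch d) (σξ σ0 η δ τp τm : ℝ),
        LabelNoiseCNN.Regime C κlo κhi τlo τhi n m d μ σξ σ0 η δ τp τm →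
        ∃ T₁ : ℕ,
          lo * (η⁻¹ * n * m * (σξ ^ 2)⁻¹ * (d : ℝ)⁻¹) ≤ T₁ ∧
          (T₁ : ℝ) ≤ hi * (η⁻¹ * n * m * (σξ ^ 2)⁻¹ * (d : ℝ)⁻¹) ∧
          -- fixed balanced labels, random noise patches and initialization
          (∀ y yObs : Fin n → ℤˣ, LabelNoiseCNN.BalancedLabels τp τm y yObs →
            LabelNoiseCNN.noiseInitLaw n m d σξ σ0
              {ω | ¬ LabelNoiseCNN.StageOneOutcome lo hi ⟨μ, y, yObs, ω.1⟩ η ω.2 T₁}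
              ≤ ENNReal.ofReal δ) ∧
          -- independent random labels
          ((MeasureTheory.Measure.pi fun _ : Fin n => LabelNoiseCNN.labelLaw τp τm).prod
              (LabelNoiseCNN.noiseInitLaw n m d σξ σ0)
              {ω | ¬ LabelNoiseCNN.StageOneOutcome lo hi
                ⟨μ, fun i => (ω.1 i).1, fun i => (ω.1 i).2, ω.2.1⟩ η ω.2.2 T₁}
              ≤ ENNReal.ofReal δ) := by
  obtain ⟨C, lo, hi, hC, hlo, hhi, h⟩ :=
    theorem4p1_general κlo κhi τhi hκ (hτlo.le.trans hτ) hτhi hκτ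
  refine ⟨C, lo, hi, by linarith, hlo, hhi, fun n m d μ σξ σ0 η δ τp τm R ↦ ?_⟩
  have hIcc := Set.Icc_subset_Icc_left (b := τhi) hτlo.le
  obtain ⟨T, hlower, hupper, hbalanced, hrandom⟩ := h n m d μ σξ σ0 η δ (R.stageOneRegime hC)
  exact ⟨T, hlower, hupper, hbalanced τp τm R.τp_mem.2 R.τm_mem.2,
    hrandom (R.mul_log_le hC) τp (hIcc R.τp_mem) τm (hIcc R.τm_mem)⟩
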